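/- A circular-arc model $\mathcal M=(C,\mathcal A)$ consists of a circle $C$ and a finite family $\mathcal A$ of open arcs $(s,t)$ of $C$ (traversed from the beginning point $s$ to the ending point $t$ in a fixed direction) such that no two extremes (beginning or ending points) of the arcs coincide. Its intersection graph has the arcs as vertices, two distinct arcs being adjacent if and only if they have a common point; an arc is universal if it intersects every other arc. Two models are equivalent if their intersection graphs are isomorphic, and $\mathcal M$ is a model of a graph $G$ if $G$ is isomorphic to the intersection graph of $\mathcal M$. The model $\mathcal M$ is proper (PCA) if no arc is contained in another arc; Helly (HCA) if every family of pairwise intersecting arcs has a common point; PHCA if it is both proper and Helly; a proper interval (PIG) model if it is proper and some point of $C$ is covered by no arc. A graph is PCA (respectively PHCA) if it has a PCA (respectively PHCA) model. A submodel of $\mathcal M$ is obtained by keeping only some of its arcs. For $k\ge 0$, $U_k(\mathcal M)$ denotes a model obtained from $\mathcal M$ by removing all but $k$ of its universal arcs (nothing is removed if there are at most $k$ of them); the choice of the remaining ones is arbitrary. $W_4$ is the graph obtained from a chordless cycle on four vertices by adding one vertex adjacent to all of them. $S_3$ is the graph with vertices $a_1,a_2,a_3,b_1,b_2,b_3$ in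 which $a_1,a_2,a_3$ are pairwise adjacent, $b_1,b_2,b_3$ are pairwise non-adjacent, and $a_i$ is adjacent to $b_j$ if and only if $i\neq j$. **Theorem.** Let $\mathcal M$ be a PCA model. For every choice of $U_1(\mathcal M)$ the following are equivalent: (i) $\mathcal M$ is equivalent to a PHCA model; (ii) $\mathcal M$ contains no submodel that is a model of $W_4$ and no submodel that is a model of $S_3$; (iii) $U_1(\mathcal M)$ is an HCA model or $U_0(\mathcal M)$ is a proper interval model. Moreover, a PCA graph is PHCA if and only if it contains no induced subgraph isomorphic to $W_4$ and no induced subgraph isomorphic to $S_3$. -/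

import Mathlib

/-- A pair of points of a circle of length `L`, read as the open arc traversed from the beginning
point `start` to the ending point `finish` in the positive direction. -/
@[ext]
structure CircleArc (L : ℝ) where
  start : AddCircle L
  finish : AddCircle L

namespace CircleArc

/-- The points of the open arc `(start, finish)`. -/
def points {L : ℝ} [Fact (0 < L)] (A : CircleArc L) : Set (AddCircle L) :=
  Set.cIoo A.start A.finish

/-- The arcs `A` and `B` have a common point. -/
def Meets {L : ℝ} [Fact (0 < L)] (A B : CircleArc L) : Prop :=
  (A.points ∩ B.points).Nonempty

end CircleArc

/-- A circular-arc model: a circle and a finite family of open arcs of it, such that no two of the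
extremes of the arcs coincide (in particular the two extremes of each arc are distinct). -/
structure CircularArcModel where
  length : ℝ
  [length_pos : Fact (0 < length)]
  arcs : Set (CircleArc length)
  finite_arcs : arcs.Finite
  start_ne_finish : ∀ A ∈ arcs, ∀ B ∈ arcs, A.start ≠ B.finish
  start_ne_start : ∀ A ∈ arcs, ∀ B ∈ arcs, A ≠ B → A.start ≠ B.start
  finish_ne_finish : ∀ A ∈ arcs, ∀ B ∈ arcs, A ≠ B → A.finish ≠ B.finish

attribute [instance] CircularArcModel.length_pos

namespace CircularArcModel

/-- The intersection graph of the arcs of a model. -/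
def intersectionGraph (M : CircularArcModel) : SimpleGraph M.arcs where
  Adj A B := A ≠ B ∧ A.1.Meets B.1
  symm := ⟨fun A B h => ⟨h.1.symm, by
    obtain ⟨p, hA, hB⟩ := h.2
    exact ⟨p, hB, hA⟩⟩⟩
  loopless := ⟨fun _ h => h.1 rfl⟩

/-- Two models are equivalent when their intersection graphs are isomorphic. -/
def Equivalent (M N : CircularArcModel) : Prop :=
  Nonempty (M.intersectionGraph ≃g N.intersectionGraph)

/-- `M` is a model of the graph `G`. -/
def IsModelOf (M : CircularArcModel) {V : Type*} (G : SimpleGraph V) : Prop :=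
  Nonempty (G ≃g M.intersectionGraph)

/-- No arc is contained in another arc. -/
def IsProper (M : CircularArcModel) : Prop :=
  ∀ A ∈ M.arcs, ∀ B ∈ M.arcs, A ≠ B → ¬ A.points ⊆ B.points

/-- Every family of pairwise intersecting arcs has a common point. -/
def IsHelly (M : CircularArcModel) : Prop :=
  ∀ F : Set (CircleArc M.length), F ⊆ M.arcs → (∀ A ∈ F, ∀ B ∈ F, A.Meets B) →
    ∃ p : AddCircle M.length, ∀ A ∈ F, p ∈ A.points

/-- Some point of the circle is covered by no arc. -/
def IsInterval (M : CircularArcModel) : Prop :=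
  ∃ p : AddCircle M.length, ∀ A ∈ M.arcs, p ∉ A.points

/-- PCA models. -/
abbrev IsPCA (M : CircularArcModel) : Prop := M.IsProper

/-- HCA models. -/
abbrev IsHCA (M : CircularArcModel) : Prop := M.IsHelly

/-- PHCA models. -/
def IsPHCA (M : CircularArcModel) : Prop := M.IsProper ∧ M.IsHelly

/-- Proper interval models. -/
def IsPIG (M : CircularArcModel) : Prop := M.IsProper ∧ M.IsInterval

/-- The submodel of `M` induced by the arcs of `M` that belong to `S`. -/
def submodel (M : CircularArcModel) (S : Set (CircleArc M.length)) : CircularArcModel where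
  length := M.length
  arcs := M.arcs ∩ S
  finite_arcs := M.finite_arcs.inter_of_left S
  start_ne_finish := fun A hA B hB => M.start_ne_finish A hA.1 B hB.1
  start_ne_start := fun A hA B hB => M.start_ne_start A hA.1 B hB.1
  finish_ne_finish := fun A hA B hB => M.finish_ne_finish A hA.1 B hB.1

/-- Some induced submodel of `M` is a model of `H`. -/
def HasInducedSubmodelOf (M : CircularArcModel) {W : Type*} (H : SimpleGraph W) : Prop :=
  ∃ S : Set (CircleArc M.length), (M.submodel S).IsModelOf H

/-- The arcs of `M` that are universal vertices of the intersection graph. -/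
def universalArcs (M : CircularArcModel) : Set (CircleArc M.length) :=
  Subtype.val '' M.intersectionGraph.universalVerts

/-- `N` arises from `M` by removing all but `k` of the universal arcs of `M` (and removing nothing
if `M` has at most `k` universal arcs); `K` is the set of the universal arcs that stay. -/
def IsU (M : CircularArcModel) (k : ℕ) (N : CircularArcModel) : Prop :=
  ∃ K : Set (CircleArc M.length), K ⊆ M.universalArcs ∧
    K.ncard = min k M.universalArcs.ncard ∧ N = M.submodel (M.universalArcsᶜ ∪ K)

/-- The model `U_k(M)` always exists. -/
theorem exists_isU (M : CircularArcModel) (k : ℕ) : ∃ N, M.IsU k N := by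
  obtain ⟨K, hK, hcard⟩ :=
    Set.exists_subset_card_eq (s := M.universalArcs) (n := min k M.universalArcs.ncard)
      (min_le_right _ _)
  exact ⟨_, K, hK, hcard, rfl⟩

end CircularArcModel

/-- PCA graphs. -/
def IsPCAGraph {V : Type*} (G : SimpleGraph V) : Prop :=
  ∃ M : CircularArcModel, M.IsPCA ∧ M.IsModelOf G

/-- PHCA graphs. -/
def IsPHCAGraph {V : Type*} (G : SimpleGraph V) : Prop :=
  ∃ M : CircularArcModel, M.IsPHCA ∧ M.IsModelOf G

/-- The `n`-wheel (for `n ≥ 4`): a cycle of length `n` together with a universal vertex `none`. -/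
def wheelGraph (n : ℕ) : SimpleGraph (Option (Fin n)) :=
  SimpleGraph.fromRel fun a b =>
    match a, b with
    | some i, some j => (SimpleGraph.cycleGraph n).Adj i j
    | _, _ => True

/-- The 3-sun `S_3`: a triangle `inl 0, inl 1, inl 2` and three pairwise non-adjacent vertices
`inr 0, inr 1, inr 2`, where `inr i` is adjacent to the two vertices `inl j` with `j ≠ i`. -/
def threeSun : SimpleGraph (Fin 3 ⊕ Fin 3) :=
  SimpleGraph.fromRel fun a b =>
    match a, b with
    | .inl i, .inl j => i ≠ j
    | .inl i, .inr j => i ≠ j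
    | _, _ => False

/-! Cut the circle at a point and read it as `[0, L)`. An arc is then straight (`s < t`) or wrapped
(`t < s`), and properness forces two arcs of the same kind to have their beginnings and their ends
in the same order. All geometry becomes linear arithmetic on extremes.

(ii) → (iii). Suppose some clique of `U₁` has no common point. Two arcs that cover the circle are
both universal, and `U₁` keeps at most one universal arc, so the clique contains three arcs that
cover the circle, no two of which do (`exists_isCoveringTriple`). If none of the three is universal,
a non-neighbour of each lies across the overlap of the other two, and the six arcs yield `S₃` or
`W₄`. If one of them is universal, it is the hub of a `W₄`, provided that the non-universal arcs
cover the circle, that is, `U₀` is not an interval model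
(`wheelGraph_isIndContained_of_isUniversal`).

(iii) → (i). An arc can be doubled by a slight shift, so universal arcs removed from `U₁` come back
as twins of the one that was kept. For a proper interval `U₀`, claw-freeness allows a first
universal arc to be inserted, and twins supply the rest.

(i) → (ii). In a PHCA model the common points of triangles contradict the linear order: for `W₄`
after cutting at the beginning of the hub, for `S₃` after cutting at a common point of the central
triangle. -/

/-- The strict cyclic order of the real line: `a`, `b`, `c` are met in this order, up to
rotation. -/
def Cyc (a b c : ℝ) : Prop := a < b ∧ b < c ∨ b < c ∧ c < a ∨ c < a ∧ a < b

/-! ### Coordinates on the circle; meeting and containment of arcs in terms of extremes. -/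

section Circle

variable {L : ℝ} [hL : Fact (0 < L)]

/-- `f` cuts the circle at `p` and identifies it with `[0, L)`, compatibly with the cyclic order. -/
structure IsCoordinate (p : AddCircle L) (f : AddCircle L → ℝ) : Prop where
  base : f p = 0
  injective : Function.Injective f
  nonneg : ∀ x, 0 ≤ f x
  lt_length : ∀ x, f x < L
  surj : ∀ r, 0 ≤ r → r < L → ∃ x, f x = r
  sbtw_iff : ∀ x y z, sbtw x y z ↔ Cyc (f x) (f y) (f z)

theorem AddCircle.sbtw_sub_iff (p x y z : AddCircle L) :
    sbtw (x - p) (y - p) (z - p) ↔ sbtw x y z := by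
  have h : ∀ x y z : AddCircle L, btw (x - p) (y - p) (z - p) ↔ btw x y z := by
    intro x y z
    change ((QuotientAddGroup.equivIcoMod hL.out 0 ((y - p) - (x - p)) : ℝ) ≤
      QuotientAddGroup.equivIocMod hL.out 0 ((z - p) - (x - p))) ↔
      ((QuotientAddGroup.equivIcoMod hL.out 0 (y - x) : ℝ) ≤
        QuotientAddGroup.equivIocMod hL.out 0 (z - x))
    rw [sub_sub_sub_cancel_right, sub_sub_sub_cancel_right]
  rw [sbtw_iff_not_btw, sbtw_iff_not_btw, h]

theorem AddCircle.sbtw_coe_iff {a b c : ℝ} (ha : 0 ≤ a) (ha' : a < L) (hb : 0 ≤ b) (hb' : b < L)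
    (hc : 0 ≤ c) (hc' : c < L) :
    sbtw (a : AddCircle L) (b : AddCircle L) (c : AddCircle L) ↔ Cyc a b c := by
  have hIco : toIcoMod hL.out 0 (b - c) = if c ≤ b then b - c else b - c + L := by
    split_ifs with h
    · rw [(toIcoMod_eq_iff hL.out)]
      exact ⟨⟨by linarith, by linarith⟩, 0, by simp⟩
    · rw [(toIcoMod_eq_iff hL.out)]
      exact ⟨⟨by linarith, by linarith⟩, -1, by simp⟩
  -- The half-open side matters at `a = c`: the representative is then `L`, not `0`.
  have hIoc : toIocMod hL.out 0 (a - c) = if c < a then a - c else a - c + L := by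
    split_ifs with h
    · rw [(toIocMod_eq_iff hL.out)]
      exact ⟨⟨by linarith, by linarith⟩, 0, by simp⟩
    · rw [(toIocMod_eq_iff hL.out)]
      exact ⟨⟨by linarith, by linarith⟩, -1, by simp⟩
  have key : btw (c : AddCircle L) (b : AddCircle L) (a : AddCircle L) ↔ _ :=
    QuotientAddGroup.btw_coe_iff' (p := L)
  rw [sbtw_iff_not_btw, key, hIco, hIoc, Cyc]
  split_ifs <;> grind

theorem exists_isCoordinate (p : AddCircle L) : ∃ f, IsCoordinate p f := by
  have hmem : ∀ x : AddCircle L, (AddCircle.equivIco L 0 x : ℝ) ∈ Set.Ico (0 : ℝ) L := fun x => by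
    have := (AddCircle.equivIco L 0 x).2
    exact ⟨this.1, this.2.trans_eq (zero_add L)⟩
  refine ⟨fun x => AddCircle.equivIco L 0 (x - p), ?_, ?_, fun x => (hmem _).1,
    fun x => (hmem _).2, ?_, ?_⟩
  · have h := AddCircle.equivIco_coe_eq (p := L) (a := 0) (x := 0)
      ⟨le_rfl, by rw [zero_add]; exact hL.out⟩
    simp only [sub_self]
    exact congrArg Subtype.val h
  · intro x y h
    exact sub_left_injective ((AddCircle.equivIco L 0).injective (Subtype.ext h))
  · intro r h0 h1
    refine ⟨(r : AddCircle L) + p, ?_⟩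
    have h := AddCircle.equivIco_coe_eq (p := L) (a := 0) (x := r)
      ⟨h0, by rw [zero_add]; exact h1⟩
    simp only [add_sub_cancel_right]
    exact congrArg Subtype.val h
  · intro x y z
    rw [← AddCircle.sbtw_sub_iff p x y z,
      ← AddCircle.sbtw_coe_iff (hmem _).1 (hmem _).2 (hmem _).1 (hmem _).2 (hmem _).1 (hmem _).2,
      AddCircle.coe_equivIco, AddCircle.coe_equivIco, AddCircle.coe_equivIco]

/-- Plays the role of an infinitesimal step forward from `s`: no point of `P` other than `s` itself
is met before passing `q`. -/
theorem exists_sbtw_right (P : Set (AddCircle L)) (hP : P.Finite) (s : AddCircle L) :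
    ∃ q, q ≠ s ∧ q ∉ P ∧ ∀ x ∈ P, x ≠ s → sbtw s q x := by
  obtain ⟨f, hf⟩ := exists_isCoordinate s
  have hpos : ∀ x, x ≠ s → 0 < f x := fun x hx =>
    lt_of_le_of_ne (hf.nonneg x) fun h => hx (hf.injective (h.symm.trans hf.base.symm))
  obtain ⟨r, h0, h1, h2⟩ : ∃ r, 0 < r ∧ r < L ∧ ∀ x ∈ P, x ≠ s → r < f x := by
    -- Inserting `L` provides a minimum when `P` has no other point, and keeps `m / 2` below `L`.
    have hfin : (insert L (f '' (P \ {s}))).Finite := ((hP.sdiff).image f).insert L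
    obtain ⟨m, hm, hmin⟩ := Set.exists_min_image _ id hfin ⟨L, Set.mem_insert _ _⟩
    have hm0 : 0 < m := by
      rcases hm with rfl | ⟨x, hx, rfl⟩
      · exact hL.out
      · exact hpos x hx.2
    have hmL : m ≤ L := hmin L (Set.mem_insert _ _)
    refine ⟨m / 2, by linarith, by linarith, fun x hx hxs => ?_⟩
    have := hmin (f x) (Set.mem_insert_of_mem _ ⟨x, ⟨hx, hxs⟩, rfl⟩)
    simp only [id] at this
    linarith
  obtain ⟨q, rfl⟩ := hf.surj r h0.le h1
  have hq : q ≠ s := fun h => by rw [h, hf.base] at h0; exact lt_irrefl _ h0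
  exact ⟨q, hq, fun hqP => lt_irrefl _ (h2 q hqP hq), fun x hx hxs =>
    (hf.sbtw_iff _ _ _).2 (Or.inl ⟨by rwa [hf.base], h2 x hx hxs⟩)⟩

theorem exists_sbtw_left (P : Set (AddCircle L)) (hP : P.Finite) (s : AddCircle L) :
    ∃ q, q ≠ s ∧ q ∉ P ∧ ∀ x ∈ P, x ≠ s → sbtw x q s := by
  obtain ⟨f, hf⟩ := exists_isCoordinate s
  have hpos : ∀ x, x ≠ s → 0 < f x := fun x hx =>
    lt_of_le_of_ne (hf.nonneg x) fun h => hx (hf.injective (h.symm.trans hf.base.symm))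
  obtain ⟨r, h0, h1, h2⟩ : ∃ r, 0 < r ∧ r < L ∧ ∀ x ∈ P, x ≠ s → f x < r := by
    have hfin : (insert 0 (f '' (P \ {s}))).Finite := ((hP.sdiff).image f).insert 0
    obtain ⟨m, hm, hmax⟩ := Set.exists_max_image _ id hfin ⟨0, Set.mem_insert _ _⟩
    have hm0 : m < L := by
      rcases hm with rfl | ⟨x, hx, rfl⟩
      · exact hL.out
      · exact hf.lt_length x
    have hmL : 0 ≤ m := hmax 0 (Set.mem_insert _ _)
    refine ⟨(m + L) / 2, by linarith, by linarith, fun x hx hxs => ?_⟩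
    have := hmax (f x) (Set.mem_insert_of_mem _ ⟨x, ⟨hx, hxs⟩, rfl⟩)
    simp only [id] at this
    linarith
  obtain ⟨q, rfl⟩ := hf.surj r h0.le h1
  have hq : q ≠ s := fun h => by rw [h, hf.base] at h0; exact lt_irrefl _ h0
  exact ⟨q, hq, fun hqP => lt_irrefl _ (h2 q hqP hq), fun x hx hxs =>
    (hf.sbtw_iff _ _ _).2 (Or.inr (Or.inr ⟨by rw [hf.base]; exact hpos x hxs, h2 x hx hxs⟩))⟩

namespace CircleArc

theorem mem_points {A : CircleArc L} {x : AddCircle L} : x ∈ A.points ↔ sbtw A.start x A.finish :=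
  Iff.rfl

theorem meets_iff {A B : CircleArc L} (hA : A.start ≠ A.finish) (hB : B.start ≠ B.finish)
    (hss : A.start ≠ B.start) (hst : A.start ≠ B.finish) (hts : B.start ≠ A.finish) :
    A.Meets B ↔ sbtw A.start B.start A.finish ∨ sbtw B.start A.start B.finish := by
  simp only [Meets, Set.Nonempty, Set.mem_inter_iff, mem_points]
  constructor
  · rintro ⟨p, h1, h2⟩
    obtain ⟨f, hf⟩ := exists_isCoordinate p
    have := hf.injective.ne hss
    simp only [hf.sbtw_iff, Cyc] at *
    grind
  · intro h
    wlog h' : sbtw B.start A.start B.finish generalizing A B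
    · obtain ⟨p, h1, h2⟩ := this hB hA hss.symm hts hst h.symm (h.resolve_right h')
      exact ⟨p, h2, h1⟩
    obtain ⟨q, -, -, hq⟩ := exists_sbtw_right {A.finish, B.start, B.finish} (by simp) A.start
    refine ⟨q, hq _ (by simp) hA.symm, ?_⟩
    have h1 := hq B.start (by simp) hss.symm
    have h2 := hq B.finish (by simp) hst.symm
    obtain ⟨f, hf⟩ := exists_isCoordinate A.start
    simp only [hf.sbtw_iff, Cyc] at *
    grind

theorem meets_self {A : CircleArc L} (hA : A.start ≠ A.finish) : A.Meets A := by
  obtain ⟨q, -, -, hq⟩ := exists_sbtw_right {A.finish} (by simp) A.start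
  have := hq _ (by simp) hA.symm
  exact ⟨q, this, this⟩

/-- Both extremes of `A` lie in `B` also when the two arcs together cover the circle; the last
conjunct excludes that case. -/
theorem points_subset_iff {A B : CircleArc L} (hA : A.start ≠ A.finish)
    (hss : A.start ≠ B.start) (hst : A.start ≠ B.finish) (hts : B.start ≠ A.finish)
    (htt : A.finish ≠ B.finish) :
    A.points ⊆ B.points ↔ sbtw B.start A.start B.finish ∧ sbtw B.start A.finish B.finish ∧
      ¬ sbtw A.start B.finish A.finish := by
  constructor
  · intro h
    obtain ⟨q, -, -, hq⟩ := exists_sbtw_right {A.finish, B.start, B.finish} (by simp) A.start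
    obtain ⟨r, -, -, hr⟩ := exists_sbtw_left {A.start, B.start, B.finish} (by simp) A.finish
    have h1 := h (hq _ (by simp) hA.symm)
    have h2 := h (hr _ (by simp) hA)
    have h3 := hq B.start (by simp) hss.symm
    have h4 := hq B.finish (by simp) hst.symm
    have h5 := hr B.start (by simp) hts
    have h6 := hr B.finish (by simp) htt.symm
    have h7 : ¬ sbtw A.start B.finish A.finish := fun h' =>
      sbtw_irrefl_right (show sbtw B.start B.finish B.finish from h h')
    rw [mem_points] at h1 h2
    clear hq hr h
    refine ⟨?_, ?_, h7⟩
    · clear h2 h5 h6 h7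
      obtain ⟨f, hf⟩ := exists_isCoordinate A.start
      simp only [hf.sbtw_iff, Cyc] at *
      grind
    · clear h1 h3 h4 h7
      obtain ⟨f, hf⟩ := exists_isCoordinate A.finish
      simp only [hf.sbtw_iff, Cyc] at *
      grind
  · rintro ⟨h1, h2, h3⟩ x hx
    rw [mem_points] at *
    obtain ⟨f, hf⟩ := exists_isCoordinate A.start
    have := hf.injective.ne htt
    have := hf.injective.ne hst
    simp only [hf.sbtw_iff, Cyc] at *
    grind

/-- If the beginning point of `A` lies in the other arcs of a finite family containing `A`, then
the whole family has a common point. -/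
theorem exists_mem_points_of_start {F : Set (CircleArc L)} (hF : F.Finite) {A : CircleArc L}
    (hA : A.start ≠ A.finish) (h : ∀ B ∈ F, B ≠ A → A.start ∈ B.points) :
    ∃ p, ∀ B ∈ F, p ∈ B.points := by
  obtain ⟨q, -, -, hq⟩ := exists_sbtw_right
    ({A.finish} ∪ (start '' F ∪ finish '' F)) ((Set.finite_singleton _).union
      ((hF.image _).union (hF.image _))) A.start
  refine ⟨q, fun B hB => ?_⟩
  by_cases hBA : B = A
  · subst hBA
    exact hq _ (by simp) hA.symm
  · have h0 := h B hB hBA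
    rw [mem_points] at *
    have h1 := hq B.start (.inr (.inl ⟨B, hB, rfl⟩))
      (fun h' => sbtw_irrefl_left (h' ▸ h0))
    have h2 := hq B.finish (.inr (.inr ⟨B, hB, rfl⟩))
      (fun h' => sbtw_irrefl_right (h' ▸ h0))
    clear hq h
    obtain ⟨f, hf⟩ := exists_isCoordinate A.start
    simp only [hf.sbtw_iff, Cyc] at *
    grind

end CircleArc

end Circle

/-- `s` and `t` are coordinates of the extremes of the arcs of a proper circular-arc model of `G`.
-/
structure SimpleGraph.ProperArcs {V : Type*} (G : SimpleGraph V) (s t : V → ℝ) : Prop where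
  start_ne_finish : ∀ i j, s i ≠ t j
  start_injective : Function.Injective s
  finish_injective : Function.Injective t
  proper : ∀ i j, i ≠ j →
    ¬ (Cyc (s j) (s i) (t j) ∧ Cyc (s j) (t i) (t j) ∧ ¬ Cyc (s i) (t j) (t i))
  adj : ∀ i j, i ≠ j → (G.Adj i j ↔ Cyc (s i) (s j) (t i) ∨ Cyc (s j) (s i) (t j))

namespace CircularArcModel

variable {M : CircularArcModel}

theorem start_injOn (M : CircularArcModel) : Set.InjOn CircleArc.start M.arcs :=
  fun A hA B hB h => by_contra fun h' => M.start_ne_start A hA B hB h' h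

theorem finish_injOn (M : CircularArcModel) : Set.InjOn CircleArc.finish M.arcs :=
  fun A hA B hB h => by_contra fun h' => M.finish_ne_finish A hA B hB h' h

theorem meets_iff {A B : CircleArc M.length} (hA : A ∈ M.arcs) (hB : B ∈ M.arcs) (h : A ≠ B) :
    A.Meets B ↔ sbtw A.start B.start A.finish ∨ sbtw B.start A.start B.finish :=
  CircleArc.meets_iff (M.start_ne_finish A hA A hA) (M.start_ne_finish B hB B hB)
    (M.start_ne_start A hA B hB h) (M.start_ne_finish A hA B hB) (M.start_ne_finish B hB A hA)

theorem points_subset_iff {A B : CircleArc M.length} (hA : A ∈ M.arcs) (hB : B ∈ M.arcs)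
    (h : A ≠ B) : A.points ⊆ B.points ↔ sbtw B.start A.start B.finish ∧
      sbtw B.start A.finish B.finish ∧ ¬ sbtw A.start B.finish A.finish :=
  CircleArc.points_subset_iff (M.start_ne_finish A hA A hA) (M.start_ne_start A hA B hB h)
    (M.start_ne_finish A hA B hB) (M.start_ne_finish B hB A hA) (M.finish_ne_finish A hA B hB h)

theorem IsProper.properArcs (hM : M.IsProper) {p : AddCircle M.length}
    {f : AddCircle M.length → ℝ} (hf : IsCoordinate p f) :
    M.intersectionGraph.ProperArcs (fun A => f A.1.start) (fun A => f A.1.finish) where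
  start_ne_finish A B := hf.injective.ne (M.start_ne_finish A.1 A.2 B.1 B.2)
  start_injective A B h := Subtype.ext (M.start_injOn A.2 B.2 (hf.injective h))
  finish_injective A B h := Subtype.ext (M.finish_injOn A.2 B.2 (hf.injective h))
  proper A B h := by
    have h' : A.1 ≠ B.1 := fun h' => h (Subtype.ext h')
    have := hM A.1 A.2 B.1 B.2 h'
    rwa [points_subset_iff A.2 B.2 h', hf.sbtw_iff, hf.sbtw_iff, hf.sbtw_iff] at this
  adj A B h := by
    have h' : A.1 ≠ B.1 := fun h' => h (Subtype.ext h')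
    rw [← hf.sbtw_iff, ← hf.sbtw_iff, ← meets_iff A.2 B.2 h']
    exact ⟨fun h => h.2, fun h'' => ⟨h, h''⟩⟩

end CircularArcModel

/-! ### Recognising the two obstructions, and basic facts on proper arcs. -/

namespace SimpleGraph

variable {V : Type*} {G : SimpleGraph V}

theorem wheelGraph_four_isIndContained {u a b c d : V} (hua : G.Adj u a) (hub : G.Adj u b)
    (huc : G.Adj u c) (hud : G.Adj u d) (hab : G.Adj a b) (hbc : G.Adj b c) (hcd : G.Adj c d)
    (hda : G.Adj d a) (hac : ¬ G.Adj a c) (hbd : ¬ G.Adj b d) (hac' : a ≠ c) (hbd' : b ≠ d) :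
    (wheelGraph 4).IsIndContained G := by
  refine ⟨⟨⟨fun x => x.elim u ![a, b, c, d], ?_⟩, ?_⟩⟩
  · have := hua.ne; have := hub.ne; have := huc.ne; have := hud.ne
    have := hab.ne; have := hbc.ne; have := hcd.ne; have := hda.ne
    rintro (_ | i) (_ | j) h
    · rfl
    · fin_cases j <;> simp_all
    · fin_cases i <;> simp_all
    · fin_cases i <;> fin_cases j <;> simp_all
  · intro x y
    change G.Adj (x.elim u ![a, b, c, d]) (y.elim u ![a, b, c, d]) ↔ _
    rcases x with _ | i <;> rcases y with _ | j
    · simp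
    · fin_cases j <;> simp [wheelGraph, *]
    · fin_cases i <;> simp [wheelGraph, *, G.adj_comm _ u]
    · have hba := hab.symm
      have hcb := hbc.symm
      have hdc := hcd.symm
      have had := hda.symm
      have hca : ¬ G.Adj c a := fun h => hac h.symm
      have hdb : ¬ G.Adj d b := fun h => hbd h.symm
      fin_cases i <;> fin_cases j <;> simp [wheelGraph, cycleGraph_adj, *] <;> decide

theorem threeSun_isIndContained {a b : Fin 3 → V} (ha : ∀ i j, i ≠ j → G.Adj (a i) (a j))
    (hab : ∀ i j, i ≠ j → G.Adj (a i) (b j)) (hab' : ∀ i, ¬ G.Adj (a i) (b i))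
    (hb : ∀ i j, ¬ G.Adj (b i) (b j)) (hne : ∀ i, a i ≠ b i) :
    threeSun.IsIndContained G := by
  refine ⟨⟨⟨Sum.elim a b, ?_⟩, ?_⟩⟩
  · rintro (i | i) (j | j) h <;> simp only [Sum.elim_inl, Sum.elim_inr] at h
    · by_contra h'
      exact (ha i j fun h'' => h' (h'' ▸ rfl)).ne h
    · by_cases h' : i = j
      · exact absurd (h' ▸ h) (hne j)
      · exact absurd h (hab i j h').ne
    · by_cases h' : j = i
      · exact absurd (h' ▸ h.symm) (hne i)
      · exact absurd h.symm (hab j i h').ne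
    · by_contra h'
      exact hab' i (h ▸ hab i j fun h'' => h' (h'' ▸ rfl))
  · have hab'' : ∀ i j, G.Adj (a i) (b j) ↔ i ≠ j := fun i j =>
      ⟨fun h h' => hab' j (h' ▸ h), hab i j⟩
    have ha'' : ∀ i j, G.Adj (a i) (a j) ↔ i ≠ j := fun i j =>
      ⟨fun h h' => G.loopless.irrefl _ (h' ▸ h), ha i j⟩
    intro x y
    change G.Adj (Sum.elim a b x) (Sum.elim a b y) ↔ _
    rcases x with i | i <;> rcases y with j | j
    · simp [threeSun, ha'', eq_comm]
    · simp [threeSun, hab'']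
    · simp [threeSun, hab'', G.adj_comm (b i)]
    · simp [threeSun, hb]

/-- If `b i` and `b j` are adjacent, then `a i, a j, b i, b j` is a chordless cycle and the third `a
k` is a hub; otherwise the six vertices form a 3-sun. -/
theorem wheelGraph_or_threeSun_isIndContained {a b : Fin 3 → V}
    (ha : ∀ i j, i ≠ j → G.Adj (a i) (a j))
    (hab : ∀ i j, i ≠ j → G.Adj (a i) (b j)) (hab' : ∀ i, ¬ G.Adj (a i) (b i))
    (hne : ∀ i, a i ≠ b i) :
    (wheelGraph 4).IsIndContained G ∨ threeSun.IsIndContained G := by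
  by_cases hb : ∀ i j, ¬ G.Adj (b i) (b j)
  · exact .inr (threeSun_isIndContained ha hab hab' hb hne)
  push Not at hb
  obtain ⟨i, j, hij⟩ := hb
  have hne' : i ≠ j := fun h => G.loopless.irrefl _ (h ▸ hij)
  obtain ⟨k, hki, hkj⟩ : ∃ k : Fin 3, k ≠ i ∧ k ≠ j := by
    clear hij
    revert i j
    decide
  exact .inl (wheelGraph_four_isIndContained (ha k i hki) (ha k j hkj) (hab k i hki)
    (hab k j hkj) (ha i j hne') (hab j i hne'.symm) hij (hab i j hne').symm (hab' i) (hab' j)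
    (hne i) (hne j))

namespace ProperArcs

variable {s t : V → ℝ}

theorem pair (h : G.ProperArcs s t) {i j : V} (hij : i ≠ j) :
    (G.Adj i j ↔ Cyc (s i) (s j) (t i) ∨ Cyc (s j) (s i) (t j)) ∧
    ¬ (Cyc (s j) (s i) (t j) ∧ Cyc (s j) (t i) (t j) ∧ ¬ Cyc (s i) (t j) (t i)) ∧
    ¬ (Cyc (s i) (s j) (t i) ∧ Cyc (s i) (t j) (t i) ∧ ¬ Cyc (s j) (t i) (t j)) ∧
    s i ≠ s j ∧ t i ≠ t j ∧ s i ≠ t j ∧ s j ≠ t i ∧ s i ≠ t i ∧ s j ≠ t j :=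
  ⟨h.adj i j hij, h.proper i j hij, h.proper j i hij.symm, h.start_injective.ne hij,
    h.finish_injective.ne hij, h.start_ne_finish _ _, h.start_ne_finish _ _,
    h.start_ne_finish _ _, h.start_ne_finish _ _⟩

/-- If neither extreme of `u` were in `a`, then `a` would be contained in `u`. -/
theorem start_or_finish_mem (h : G.ProperArcs s t) {u a : V} (hua : G.Adj u a) :
    Cyc (s a) (s u) (t a) ∨ Cyc (s a) (t u) (t a) := by
  have := h.pair hua.ne
  simp only [Cyc] at *
  grind -ring (splits := 40)

theorem adj_of_mem (h : G.ProperArcs s t) {a b : V} {x : ℝ} (hab : a ≠ b)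
    (ha : Cyc (s a) x (t a)) (hb : Cyc (s b) x (t b)) : G.Adj a b := by
  have := h.pair hab
  simp only [Cyc] at *
  grind -ring (splits := 40)

/-- Each neighbour of `u` contains one of the two extremes of `u`, so two of any three share one and
meet. -/
theorem not_claw (h : G.ProperArcs s t) {u a b c : V} (hua : G.Adj u a) (hub : G.Adj u b)
    (huc : G.Adj u c) (hab : a ≠ b) (hac : a ≠ c) (hbc : b ≠ c) (hab' : ¬ G.Adj a b)
    (hac' : ¬ G.Adj a c) (hbc' : ¬ G.Adj b c) : False := by
  rcases h.start_or_finish_mem hua with h1 | h1 <;>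
  rcases h.start_or_finish_mem hub with h2 | h2 <;>
  rcases h.start_or_finish_mem huc with h3 | h3
  all_goals first
    | exact hab' (h.adj_of_mem hab h1 h2)
    | exact hac' (h.adj_of_mem hac h1 h3)
    | exact hbc' (h.adj_of_mem hbc h2 h3)

/-- Of two arcs that cover the circle, the first is universal. -/
theorem isUniversal_left (h : G.ProperArcs s t) {a b : V} (hab : a ≠ b)
    (h1 : Cyc (s b) (s a) (t b)) (h2 : Cyc (s b) (t a) (t b)) : G.IsUniversal a := by
  intro c hac
  by_cases hbc : b = c
  · subst hbc
    have := h.pair hab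
    exact this.1.2 (.inr h1)
  -- An arc `c` disjoint from `a` would be contained in `b`, since `a` and `b` cover the circle.
  have p1 := h.pair hab
  have p2 := h.pair hac
  have p3 := h.pair hbc
  simp only [Cyc] at *
  grind -ring (splits := 40)

/-- By properness the covering hypothesis is symmetric in `a` and `b`. -/
theorem isUniversal_right (h : G.ProperArcs s t) {a b : V} (hab : a ≠ b)
    (h1 : Cyc (s b) (s a) (t b)) (h2 : Cyc (s b) (t a) (t b)) : G.IsUniversal b := by
  have := h.pair hab
  apply h.isUniversal_left hab.symm (b := a) <;> simp only [Cyc] at * <;> grind -ring (splits := 40)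

end ProperArcs
end SimpleGraph

/-! ### Covering triples and the obstructions they force. -/

namespace SimpleGraph

variable {V : Type*} {G : SimpleGraph V} {s t : V → ℝ}

/-- The arcs `a i` cover the circle, which is cut at the beginning of `a 0`, and any two of them,
but not all three, have a common point. -/
structure IsCoveringTriple (s t : V → ℝ) (a : Fin 3 → V) : Prop where
  start_le_start : ∀ i, s (a 0) ≤ s i
  start_lt_finish : ∀ i, s (a 0) < t i
  lt₁ : t (a 2) < s (a 1)
  lt₂ : s (a 1) < t (a 0)
  lt₃ : t (a 0) < s (a 2)
  lt₄ : s (a 2) < t (a 1)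

namespace ProperArcs

theorem adj_triple (h : G.ProperArcs s t) {a : Fin 3 → V} (ha : IsCoveringTriple s t a) :
    ∀ i j, i ≠ j → G.Adj (a i) (a j) := by
  obtain ⟨-, h2, h3, h4, h5, h6⟩ := ha
  have h02 := h2 (a 2)
  have h01 : a 0 ≠ a 1 := fun e => by rw [e] at h02; linarith
  have h12 : a 1 ≠ a 2 := fun e => by rw [e] at h4; linarith
  have h02' : a 0 ≠ a 2 := fun e => by rw [← e] at h3; linarith
  have p01 := (h.adj _ _ h01).2 (.inl (.inl ⟨by linarith, by linarith⟩))
  have p12 := (h.adj _ _ h12).2 (.inl (.inl ⟨by linarith, by linarith⟩))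
  have p02 := (h.adj _ _ h02').2 (.inr (.inr (.inl ⟨by linarith, by linarith⟩)))
  intro i j hij
  fin_cases i <;> fin_cases j
  exacts [absurd rfl hij, p01, p02, p01.symm, absurd rfl hij, p12, p02.symm, p12.symm,
    absurd rfl hij]

theorem start_lt_start_iff (h : G.ProperArcs s t) {i j : V} (hij : i ≠ j)
    (hw : s i < t i ↔ s j < t j) : s i < s j ↔ t i < t j := by
  have := h.pair hij
  simp only [Cyc] at this
  grind -ring (splits := 40)

theorem lt_of_wrapped_of_straight (h : G.ProperArcs s t) {i j : V} (hi : t i < s i)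
    (hj : s j < t j) : s j < s i ∧ t i < t j := by
  have := h.pair (i := i) (j := j) (by rintro rfl; linarith)
  simp only [Cyc] at this
  grind -ring (splits := 40)

theorem adj_of_wrapped (h : G.ProperArcs s t) {i j : V} (hij : i ≠ j) (hi : t i < s i)
    (hj : t j < s j) : G.Adj i j := by
  have := h.pair hij
  simp only [Cyc] at this
  grind -ring (splits := 40)

theorem adj_iff_of_wrapped_of_straight (h : G.ProperArcs s t) {i j : V} (hi : t i < s i)
    (hj : s j < t j) : G.Adj i j ↔ s j < t i ∨ s i < t j := by
  have := h.pair (i := i) (j := j) (by rintro rfl; linarith)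
  simp only [Cyc] at this
  grind -ring (splits := 40)

theorem adj_iff_of_straight (h : G.ProperArcs s t) {i j : V} (hij : i ≠ j) (hi : s i < t i)
    (hj : s j < t j) : G.Adj i j ↔ s i < t j ∧ s j < t i := by
  have := h.pair hij
  simp only [Cyc] at this
  grind -ring (splits := 40)

section Witness

variable (h : G.ProperArcs s t) {a : Fin 3 → V} (ha : IsCoveringTriple s t a)
include h ha

/-- The arc `b` lies in the complement of `a 0`, which `a 1` and `a 2` cover; as it is contained in
neither, it extends past the end of `a 1` and begins before `a 2`. The two analogues below are the
same fact seen from a different cut. -/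
theorem order_of_not_adj_zero {b : V} (hb : a 0 ≠ b) (hb' : ¬ G.Adj (a 0) b) :
    t (a 0) < s b ∧ s b < s (a 2) ∧ t (a 1) < t b := by
  have h01 := h.adj_triple ha 0 1 (by decide)
  have h02 := h.adj_triple ha 0 2 (by decide)
  obtain ⟨h1, h2, h3, h4, h5, h6⟩ := ha
  have p0 := h.pair hb
  have p1 := h.pair (i := a 1) (j := b) (fun e => hb' (e ▸ h01))
  have p2 := h.pair (i := a 2) (j := b) (fun e => hb' (e ▸ h02))
  have := h1 b
  have := h2 b
  have := h2 (a 2)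
  simp only [Cyc] at *
  clear h1 h2
  grind -ring (splits := 40)

theorem order_of_not_adj_one {b : V} (hb : a 1 ≠ b) (hb' : ¬ G.Adj (a 1) b) :
    t (a 1) < s b ∧ t (a 2) < t b ∧ t b < s (a 1) := by
  have h01 := h.adj_triple ha 1 0 (by decide)
  have h02 := h.adj_triple ha 1 2 (by decide)
  obtain ⟨h1, h2, h3, h4, h5, h6⟩ := ha
  have p0 := h.pair (i := a 0) (j := b) (fun e => hb' (e ▸ h01))
  have p1 := h.pair hb
  have p2 := h.pair (i := a 2) (j := b) (fun e => hb' (e ▸ h02))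
  have := h1 b
  have := h2 b
  have := h2 (a 2)
  simp only [Cyc] at *
  clear h1 h2
  grind -ring (splits := 40)

theorem order_of_not_adj_two {b : V} (hb : a 2 ≠ b) (hb' : ¬ G.Adj (a 2) b) :
    t (a 2) < s b ∧ s b < s (a 1) ∧ t (a 0) < t b ∧ t b < s (a 2) := by
  have h01 := h.adj_triple ha 2 0 (by decide)
  have h02 := h.adj_triple ha 2 1 (by decide)
  obtain ⟨h1, h2, h3, h4, h5, h6⟩ := ha
  have p0 := h.pair (i := a 0) (j := b) (fun e => hb' (e ▸ h01))
  have p1 := h.pair (i := a 1) (j := b) (fun e => hb' (e ▸ h02))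
  have p2 := h.pair hb
  have := h1 b
  have := h2 b
  have := h2 (a 2)
  simp only [Cyc] at *
  clear h1 h2
  grind -ring (splits := 40)

theorem wheelGraph_or_threeSun_of_not_universal (hu : ∀ i, ¬ G.IsUniversal (a i)) :
    (wheelGraph 4).IsIndContained G ∨ threeSun.IsIndContained G := by
  simp only [IsUniversal, not_forall] at hu
  choose b hne hb using hu
  refine wheelGraph_or_threeSun_isIndContained (h.adj_triple ha) ?_ hb hne
  obtain ⟨b0, b0', b0''⟩ := h.order_of_not_adj_zero ha (hne 0) (hb 0)
  obtain ⟨b1, b1', b1''⟩ := h.order_of_not_adj_one ha (hne 1) (hb 1)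
  obtain ⟨b2, b2', b2'', b2'''⟩ := h.order_of_not_adj_two ha (hne 2) (hb 2)
  have hab : ∀ i j, i ≠ j → a i ≠ b j := fun i j hij e =>
    hb j (e ▸ h.adj_triple ha j i hij.symm)
  obtain ⟨h1, h2, h3, h4, h5, h6⟩ := ha
  intro i j hij
  rw [h.adj _ _ (hab i j hij)]
  have := h2 (a 2)
  have := h2 (b 1)
  simp only [Cyc]
  clear hab hb hne h1 h2 h
  fin_cases i <;> fin_cases j <;> simp only [Fin.zero_eta, Fin.mk_one, Fin.reduceFinMk] at *
  all_goals grind -ring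

/-- The hub is always `a 0`. If non-neighbours `b₁` of `a 1` and `b₂` of `a 2` meet, they close the
rim. Otherwise a non-universal arc `x` covers the end of `b₁`, and with a non-neighbour `z` of `x`
it completes one of the pairs `a 1, b₁` and `a 2, b₂` to a rim. -/
theorem wheelGraph_isIndContained_of_isUniversal [Finite V] (hu0 : G.IsUniversal (a 0))
    (hu1 : ¬ G.IsUniversal (a 1)) (hu2 : ¬ G.IsUniversal (a 2))
    (hcov : ∀ i, ∃ x, ¬ G.IsUniversal x ∧ Cyc (s x) (t i) (t x)) :
    (wheelGraph 4).IsIndContained G := by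
  have tri := h.adj_triple ha
  have ord1 := fun b => h.order_of_not_adj_one ha (b := b)
  have ord2 := fun b => h.order_of_not_adj_two ha (b := b)
  obtain ⟨h1, h2, h3, h4, h5, h6⟩ := ha
  simp only [IsUniversal, not_forall] at hu1 hu2
  -- The extremal choices, last end for `b₁` and first beginning for `b₂`, will force `x` to reach
  -- `a 1` or `a 2`: otherwise `x` would be a better choice.
  obtain ⟨b₁, ⟨n1, m1⟩, max1⟩ := Set.exists_max_image {b | a 1 ≠ b ∧ ¬ G.Adj (a 1) b} t
    (Set.toFinite _) (by obtain ⟨b, hb, hb'⟩ := hu1; exact ⟨b, hb, hb'⟩)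
  obtain ⟨b₂, ⟨n2, m2⟩, min2⟩ := Set.exists_min_image {b | a 2 ≠ b ∧ ¬ G.Adj (a 2) b} s
    (Set.toFinite _) (by obtain ⟨b, hb, hb'⟩ := hu2; exact ⟨b, hb, hb'⟩)
  obtain ⟨o1, o1', o1''⟩ := ord1 b₁ n1 m1
  obtain ⟨o2, o2', o2'', o2'''⟩ := ord2 b₂ n2 m2
  have e0 := h2 (a 2)
  have adj (i j : V) (hij : s i ≠ s j) := h.adj i j fun e => hij (e ▸ rfl)
  have a2b1 : G.Adj (a 2) b₁ :=
    (adj _ _ (by linarith)).2 (.inl (.inr (.inr ⟨by linarith, by linarith⟩)))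
  have b2a1 : G.Adj b₂ (a 1) := (adj _ _ (by linarith)).2 (.inl (.inl ⟨by linarith, by linarith⟩))
  have a01 := tri 0 1 (by decide)
  have a02 := tri 0 2 (by decide)
  have a12 := tri 1 2 (by decide)
  have ub1 : G.Adj (a 0) b₁ := hu0 fun e => m1 (e ▸ a01.symm)
  have ub2 : G.Adj (a 0) b₂ := hu0 fun e => m2 (e ▸ a02.symm)
  by_cases hb : G.Adj b₁ b₂
  · exact wheelGraph_four_isIndContained a01 a02 ub1 ub2 a12 a2b1 hb b2a1 m1 m2 n1 n2
  have hlt : t b₁ < s b₂ := by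
    refine lt_of_le_of_ne (not_lt.1 fun hlt => hb ?_) (h.start_ne_finish _ _).symm
    exact (adj _ _ (by linarith)).2 (.inl (.inr (.inl ⟨by linarith, by linarith⟩)))
  obtain ⟨x, hx, hxc⟩ := hcov b₁
  have x0 : a 0 ≠ x := fun e => hx (e ▸ hu0)
  have ux : G.Adj (a 0) x := hu0 x0
  have hx' := hx
  simp only [IsUniversal, not_forall] at hx'
  obtain ⟨z, hxz, hz⟩ := hx'
  have z0 : a 0 ≠ z := fun e => hz (e ▸ ux.symm)
  have uz : G.Adj (a 0) z := hu0 z0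
  have t0x := h2 x
  have t0z := h2 z
  have s0x := lt_of_le_of_ne (h1 x) (h.start_injective.ne x0)
  have s0z := lt_of_le_of_ne (h1 z) (h.start_injective.ne z0)
  have w0 : s (a 0) < t (a 0) := h2 _
  rcases lt_or_gt_of_ne (h.start_ne_finish x x) with hwx | hwx
  · -- `x` does not contain the beginning of `a 0`
    have q1 : s x < t b₁ := by
      rcases hxc with hc | hc | hc <;> linarith
    have q2 : t (a 0) < t x := (h.start_lt_start_iff x0 (by simp [hwx, w0])).1 s0x
    have xb2 : x ≠ b₂ := fun e => by rw [e] at q1; linarith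
    have q4 : t x < t b₂ := (h.start_lt_start_iff xb2 (iff_of_true hwx (by linarith))).1
      (by linarith)
    have q3 : s x < t (a 2) := by
      by_contra hlt'
      have hx2 : ¬ G.Adj (a 2) x := by
        rw [h.adj_iff_of_wrapped_of_straight (by linarith) hwx]
        rintro (hc | hc) <;> linarith
      have := min2 x ⟨fun e => by rw [← e] at hwx; linarith, hx2⟩
      linarith
    -- A straight `z` would contain the end of `a 0`, as `x` does, and so meet `x`.
    have wz : t z < s z := by
      refine lt_of_le_of_ne (not_lt.1 fun wz => ?_) (h.start_ne_finish _ _).symm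
      have := (h.start_lt_start_iff z0 (iff_of_true w0 wz)).1 s0z
      have h1' := (h.adj_iff_of_straight z0 w0 wz).1 uz
      have h2' := (h.adj_iff_of_straight hxz hwx wz).not.1 hz
      exact h2' ⟨by linarith, by linarith⟩
    have zz := (h.adj_iff_of_wrapped_of_straight wz hwx).not.1 fun hc => hz hc.symm
    rw [not_or, not_lt, not_lt] at zz
    obtain ⟨z1, z2⟩ := zz
    have z3 : s z < s (a 2) :=
      (h.start_lt_start_iff (fun e => by rw [e] at z1; linarith)
        (iff_of_false (by linarith) (by linarith))).2 (by linarith)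
    have z4 : s z < s b₁ :=
      (h.start_lt_start_iff (fun e => by rw [e] at z1; linarith)
        (iff_of_false (by linarith) (by linarith))).2 (by linarith)
    have x1 : G.Adj x (a 1) := (adj _ _ (by linarith)).2 (.inl (.inl ⟨by linarith, by linarith⟩))
    have a1z : G.Adj (a 1) z := (adj _ _ (by linarith)).2 (.inl (.inl ⟨by linarith, by linarith⟩))
    have zb1 : G.Adj z b₁ :=
      (adj _ _ (by linarith)).2 (.inl (.inr (.inr ⟨by linarith, by linarith⟩)))
    have b1x : G.Adj b₁ x :=
      (adj _ _ (by linarith)).2 (.inl (.inr (.inl ⟨by linarith, by linarith⟩)))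
    exact wheelGraph_four_isIndContained ux a01 uz ub1 x1 a1z zb1 b1x hz m1 hxz n1
  · -- `x` contains the beginning of `a 0`
    obtain ⟨-, q3⟩ := h.lt_of_wrapped_of_straight hwx w0
    have q1 : t b₁ < t x := by
      rcases hxc with hc | hc | hc
      · linarith
      · exact hc.1
      -- Here `x` and `a 0` would cover the circle, which makes `x` universal.
      · exact absurd (h.isUniversal_right x0 (.inr (.inl ⟨t0x, hwx⟩))
          (.inr (.inr ⟨hwx, by linarith⟩))) hx
    have q2 : s b₁ < s x :=
      (h.start_lt_start_iff (fun e => by rw [e] at q1; linarith)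
        (iff_of_false (by linarith) (by linarith))).2 q1
    have q4 : s (a 1) < t x := by
      by_contra hlt'
      have hx1 : ¬ G.Adj (a 1) x := by
        rw [G.adj_comm, h.adj_iff_of_wrapped_of_straight hwx (by linarith)]
        rintro (hc | hc) <;> linarith
      have := max1 x ⟨fun e => by rw [← e] at q2; linarith, hx1⟩
      linarith
    have wz : s z < t z :=
      lt_of_le_of_ne (not_lt.1 fun wz => hz (h.adj_of_wrapped hxz hwx wz)) (h.start_ne_finish _ _)
    have zz := (h.adj_iff_of_wrapped_of_straight hwx wz).not.1 hz
    rw [not_or, not_lt, not_lt] at zz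
    obtain ⟨z1, z2⟩ := zz
    have z3 := (h.adj_iff_of_straight z0 w0 wz).1 uz
    have z4 : t (a 1) < t z :=
      (h.start_lt_start_iff (fun e => by rw [← e] at z1; linarith)
        (iff_of_true (by linarith) wz)).1 (by linarith)
    have x2 : G.Adj x (a 2) :=
      (adj _ _ (by linarith)).2 (.inr (.inr (.inr ⟨by linarith, by linarith⟩)))
    have a2z : G.Adj (a 2) z := (adj _ _ (by linarith)).2 (.inr (.inl ⟨by linarith, by linarith⟩))
    have zb2 : G.Adj z b₂ :=
      (adj _ _ (by linarith)).2 (.inr (.inl ⟨by linarith, by linarith⟩))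
    have b2x : G.Adj b₂ x :=
      (adj _ _ (by linarith)).2 (.inr (.inr (.inl ⟨by linarith, by linarith⟩)))
    exact wheelGraph_four_isIndContained ux a02 uz ub2 x2 a2z zb2 b2x hz m2 hxz n2

end Witness

end ProperArcs
end SimpleGraph

/-! ### Covering triples in cliques without a common point; absence of the obstructions under the
Helly property. -/

namespace SimpleGraph

variable {V : Type*} {G : SimpleGraph V} {s t : V → ℝ}

namespace ProperArcs

/-- A clique of arcs, no two of which cover the circle, contains a covering triple or an arc that
begins in all the others. -/
theorem exists_isCoveringTriple [Finite V] (h : G.ProperArcs s t) {F : Set V}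
    (hF : F.Pairwise G.Adj)
    (hcov : ∀ i ∈ F, ∀ j ∈ F, i ≠ j → ¬ (Cyc (s j) (s i) (t j) ∧ Cyc (s j) (t i) (t j)))
    (hno : ∀ i ∈ F, ∃ j ∈ F, j ≠ i ∧ ¬ Cyc (s j) (s i) (t j)) {o : V} (ho : o ∈ F)
    (h1 : ∀ i, s o ≤ s i) (h2 : ∀ i, s o < t i) :
    ∃ a : Fin 3 → V, (∀ i, a i ∈ F) ∧ IsCoveringTriple s t a := by
  have hlt : ∀ i, o ≠ i → s o < s i := fun i hi => lt_of_le_of_ne (h1 i) (h.start_injective.ne hi)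
  -- The last straight arc to begin. One exists because wrapped arcs contain the beginning of `o`,
  -- which some member of `F` misses.
  obtain ⟨c, ⟨hcF, hco, hc⟩, hmax⟩ := Set.exists_max_image {i | i ∈ F ∧ o ≠ i ∧ s i < t i} s
    (Set.toFinite _) (by
      obtain ⟨j, hj, hjo, hj'⟩ := hno o ho
      refine ⟨j, hj, hjo.symm, lt_of_le_of_ne (not_lt.1 fun hw => hj' ?_) (h.start_ne_finish _ _)⟩
      exact .inr (.inl ⟨h2 j, hw⟩))
  have hR : ∀ i ∈ F, o ≠ i → s i < t i → s i < t o ∧ t o < t i := fun i hi hoi hw =>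
    ⟨((h.adj_iff_of_straight hoi (h2 o) hw).1 (hF ho hi hoi)).2,
      (h.start_lt_start_iff hoi (iff_of_true (h2 o) hw)).1 (hlt i hoi)⟩
  obtain ⟨hc1, hc2⟩ := hR c hcF hco hc
  -- The third arc misses the beginning of `c`; every straight member of `F` other than `c` contains
  -- it, so `b` is wrapped.
  obtain ⟨b, hb, hbc, hb'⟩ := hno c hcF
  have hbo : o ≠ b := by
    rintro rfl
    exact hb' (.inl ⟨hlt c hco, hc1⟩)
  have hbw : t b < s b := by
    refine lt_of_le_of_ne (not_lt.1 fun hw => hb' ?_) (h.start_ne_finish _ _).symm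
    exact .inl ⟨lt_of_le_of_ne (hmax b ⟨hb, hbo, hw⟩) (h.start_injective.ne hbc),
      hc1.trans (hR b hb hbo hw).2⟩
  have b1 : t b < s c := by
    refine lt_of_le_of_ne (not_lt.1 fun hw => hb' ?_) (h.start_ne_finish _ _).symm
    exact .inr (.inl ⟨hw, hbw⟩)
  have b2 : s c < s b := by
    refine lt_of_le_of_ne (not_lt.1 fun hw => hb' ?_) (h.start_injective.ne hbc).symm
    exact .inr (.inr ⟨hbw, hw⟩)
  have b3 : s b < t c := by
    rcases (h.adj_iff_of_wrapped_of_straight hbw hc).1 (hF hb hcF hbc) with h' | h'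
    · linarith
    · exact h'
  have b4 : t o < s b := by
    refine lt_of_le_of_ne (not_lt.1 fun hw => hcov o ho b hb hbo ?_) (h.start_ne_finish _ _).symm
    exact ⟨.inr (.inl ⟨h2 b, hbw⟩), .inr (.inr ⟨hbw, hw⟩)⟩
  refine ⟨![o, c, b], ?_, h1, h2, b1, hc1, b4, b3⟩
  intro i
  fin_cases i
  exacts [ho, hcF, hb]

/-- No wheel: two arcs `w₁`, `w₂` meet the beginning of `u` and two arcs `x₁`, `x₂` its end. -/
theorem false_of_two_common_points (h : G.ProperArcs s t) {u w₁ w₂ x₁ x₂ : V}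
    (h1 : ∀ i, s u ≤ s i) (h2 : ∀ i, s u < t i) {p q : ℝ} (ux1 : G.Adj u x₁) (ux2 : G.Adj u x₂)
    (hw1 : t w₁ < s w₁) (hw2 : t w₂ < s w₂) (hx1 : s x₁ < t x₁) (hx2 : s x₂ < t x₂)
    (n1 : ¬ G.Adj w₁ x₁) (n2 : ¬ G.Adj w₂ x₂)
    (pu : Cyc (s u) p (t u)) (pw : Cyc (s w₁) p (t w₁)) (px : Cyc (s x₂) p (t x₂))
    (qu : Cyc (s u) q (t u)) (qw : Cyc (s w₂) q (t w₂)) (qx : Cyc (s x₁) q (t x₁)) : False := by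
  have hu := h2 u
  have a1 := (h.adj_iff_of_straight ux1.ne hu hx1).1 ux1
  have a2 := (h.adj_iff_of_straight ux2.ne hu hx2).1 ux2
  have e1 := (h.start_lt_start_iff ux1.ne (iff_of_true hu hx1)).1
    (lt_of_le_of_ne (h1 _) (h.start_injective.ne ux1.ne))
  have e2 := (h.start_lt_start_iff ux2.ne (iff_of_true hu hx2)).1
    (lt_of_le_of_ne (h1 _) (h.start_injective.ne ux2.ne))
  have m1 := (h.adj_iff_of_wrapped_of_straight hw1 hx1).not.1 n1
  have m2 := (h.adj_iff_of_wrapped_of_straight hw2 hx2).not.1 n2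
  simp only [not_or, not_lt, Cyc] at *
  clear h1 h2
  grind -ring

/-- With the cut at the beginning of the hub, wrapped arcs share that beginning and straight
neighbours of `u` reach its end. Hence each non-adjacent rim pair has one arc of each kind, and two
opposite rim edges join a wrapped arc to a straight one; their common points with `u` conflict. -/
theorem false_of_wheel (h : G.ProperArcs s t) {u a b c d : V}
    (h1 : ∀ i, s u ≤ s i) (h2 : ∀ i, s u < t i)
    (helly : ∀ i j k, G.Adj i j → G.Adj i k → G.Adj j k →
      ∃ p, Cyc (s i) p (t i) ∧ Cyc (s j) p (t j) ∧ Cyc (s k) p (t k))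
    (hua : G.Adj u a) (hub : G.Adj u b) (huc : G.Adj u c) (hud : G.Adj u d) (hab : G.Adj a b)
    (hbc : G.Adj b c) (hcd : G.Adj c d) (hda : G.Adj d a) (hac : ¬ G.Adj a c)
    (hbd : ¬ G.Adj b d) (hac' : a ≠ c) (hbd' : b ≠ d) : False := by
  have key : ∀ {x y}, G.Adj u x → G.Adj u y → x ≠ y → ¬ G.Adj x y →
      t x < s x ∧ s y < t y ∨ t y < s y ∧ s x < t x := by
    intro x y hx hy hxy hn
    have hu := h2 u
    rcases lt_or_gt_of_ne (h.start_ne_finish x x) with wx | wx <;>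
    rcases lt_or_gt_of_ne (h.start_ne_finish y y) with wy | wy
    · have a1 := (h.adj_iff_of_straight hx.ne hu wx).1 hx
      have a2 := (h.adj_iff_of_straight hy.ne hu wy).1 hy
      have e1 := (h.start_lt_start_iff hx.ne (iff_of_true hu wx)).1
        (lt_of_le_of_ne (h1 _) (h.start_injective.ne hx.ne))
      have e2 := (h.start_lt_start_iff hy.ne (iff_of_true hu wy)).1
        (lt_of_le_of_ne (h1 _) (h.start_injective.ne hy.ne))
      exact absurd ((h.adj_iff_of_straight hxy wx wy).2 ⟨by linarith, by linarith⟩) hn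
    · exact .inr ⟨wy, wx⟩
    · exact .inl ⟨wx, wy⟩
    · exact absurd (h.adj_of_wrapped hxy wx wy) hn
  obtain ⟨p, p1, p2, p3⟩ := helly u a b hua hub hab
  obtain ⟨q, q1, q2, q3⟩ := helly u b c hub huc hbc
  obtain ⟨r, r1, r2, r3⟩ := helly u c d huc hud hcd
  obtain ⟨v, v1, v2, v3⟩ := helly u d a hud hua hda
  have hca : ¬ G.Adj c a := fun h' => hac h'.symm
  have hdb : ¬ G.Adj d b := fun h' => hbd h'.symm
  rcases key hua huc hac' hac with ⟨wa, wc⟩ | ⟨wc, wa⟩ <;>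
  rcases key hub hud hbd' hbd with ⟨wb, wd⟩ | ⟨wd, wb⟩
  · exact h.false_of_two_common_points h1 h2 huc hud wa wb wc wd hac hbd v1 v3 v2 q1 q2 q3
  · exact h.false_of_two_common_points h1 h2 huc hub wa wd wc wb hac hdb p1 p2 p3 r1 r3 r2
  · exact h.false_of_two_common_points h1 h2 hua hud wc wb wa wd hca hbd r1 r2 r3 p1 p3 p2
  · exact h.false_of_two_common_points h1 h2 hua hub wc wd wa wb hca hdb q1 q3 q2 v1 v2 v3

/-- A point of both `x` and `z` outside the intermediate arc `y` satisfies `s x < q < t z`. The arc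
`b`, avoiding `x` but not contained in `z`, gives `t z < t b ≤ s x`. -/
theorem false_of_wrapped (h : G.ProperArcs s t) {x y z b c : V} (wx : t x < s x)
    (wy : t y < s y) (wz : t z < s z) (hxy : t x < t y) (hyz : t y < t z) {q : ℝ}
    (qx : Cyc (s x) q (t x)) (qz : Cyc (s z) q (t z)) (qc : Cyc (s c) q (t c))
    (hyc : ¬ G.Adj y c) (hyc' : y ≠ c) (hxb : ¬ G.Adj x b) (hxb' : x ≠ b) : False := by
  have wb : s b < t b := lt_of_le_of_ne (not_lt.1 fun w => hxb (h.adj_of_wrapped hxb' wx w))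
    (h.start_ne_finish _ _)
  have e1 := (h.adj_iff_of_wrapped_of_straight wx wb).not.1 hxb
  have e2 := h.lt_of_wrapped_of_straight wz wb
  have e3 : s x < s y := (h.start_lt_start_iff (by rintro rfl; linarith)
    (iff_of_false (by linarith) (by linarith))).2 hxy
  have e4 : s y < s z := (h.start_lt_start_iff (by rintro rfl; linarith)
    (iff_of_false (by linarith) (by linarith))).2 hyz
  have e5 : ¬ Cyc (s y) q (t y) := fun hq => hyc (h.adj_of_mem hyc' hq qc)
  simp only [not_or, not_lt, Cyc] at *
  grind -ring

/-- Among the three wrapped arcs the one with the middle end, `a j`, is singled out; the common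
point of the other two with `b j` lies outside `a j`. -/
theorem false_of_threeSun (h : G.ProperArcs s t) {a b : Fin 3 → V}
    (helly : ∀ i j k, G.Adj i j → G.Adj i k → G.Adj j k →
      ∃ p, Cyc (s i) p (t i) ∧ Cyc (s j) p (t j) ∧ Cyc (s k) p (t k))
    (hw : ∀ i, t (a i) < s (a i)) (ha : ∀ i j, i ≠ j → G.Adj (a i) (a j))
    (hab : ∀ i j, i ≠ j → G.Adj (a i) (b j)) (hab' : ∀ i, ¬ G.Adj (a i) (b i))
    (hne : ∀ i, a i ≠ b i) : False := by
  have key : ∀ i j k : Fin 3, i ≠ j → i ≠ k → j ≠ k → t (a i) < t (a j) → t (a j) < t (a k) →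
      False := by
    intro i j k hij hik hjk h1 h2
    obtain ⟨q, q1, q2, q3⟩ := helly (a i) (a k) (b j) (ha i k hik) (hab i j hij)
      (hab k j hjk.symm)
    exact h.false_of_wrapped (hw i) (hw j) (hw k) h1 h2 q1 q2 q3 (hab' j) (hne j) (hab' i) (hne i)
  have d01 := h.finish_injective.ne (ha 0 1 (by decide)).ne
  have d02 := h.finish_injective.ne (ha 0 2 (by decide)).ne
  have d12 := h.finish_injective.ne (ha 1 2 (by decide)).ne
  rcases lt_or_gt_of_ne d01 with h01 | h01 <;> rcases lt_or_gt_of_ne d02 with h02 | h02 <;>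
  rcases lt_or_gt_of_ne d12 with h12 | h12
  · exact key 0 1 2 (by decide) (by decide) (by decide) h01 h12
  · exact key 0 2 1 (by decide) (by decide) (by decide) h02 h12
  · linarith
  · exact key 2 0 1 (by decide) (by decide) (by decide) h02 h01
  · exact key 1 0 2 (by decide) (by decide) (by decide) h01 h02
  · linarith
  · exact key 1 2 0 (by decide) (by decide) (by decide) h12 h02
  · exact key 2 1 0 (by decide) (by decide) (by decide) h12 h01

end ProperArcs
end SimpleGraph

open SimpleGraph

/-! ### Back to models: (i) → (ii) and (ii) → (iii). -/

namespace CircularArcModel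

variable {M : CircularArcModel}

theorem IsHelly.exists_common (hM : M.IsHelly) {A B C : M.arcs}
    (hAB : M.intersectionGraph.Adj A B) (hAC : M.intersectionGraph.Adj A C)
    (hBC : M.intersectionGraph.Adj B C) :
    ∃ p, p ∈ A.1.points ∧ p ∈ B.1.points ∧ p ∈ C.1.points := by
  have hself : ∀ D : M.arcs, D.1.Meets D.1 := fun D =>
    CircleArc.meets_self (M.start_ne_finish D.1 D.2 D.1 D.2)
  obtain ⟨p, hp⟩ := hM {A.1, B.1, C.1} (by
      rintro D (rfl | rfl | rfl)
      exacts [A.2, B.2, C.2]) (by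
      rintro D (rfl | rfl | rfl) E (rfl | rfl | rfl)
      exacts [hself A, hAB.2, hAC.2, hAB.symm.2, hself B, hBC.2, hAC.symm.2, hBC.symm.2, hself C])
  exact ⟨p, hp _ (by simp), hp _ (by simp), hp _ (by simp)⟩

theorem IsPHCA.helly_coordinates (hM : M.IsPHCA) {p : AddCircle M.length}
    {f : AddCircle M.length → ℝ} (hf : IsCoordinate p f) (i j k : M.arcs)
    (hij : M.intersectionGraph.Adj i j) (hik : M.intersectionGraph.Adj i k)
    (hjk : M.intersectionGraph.Adj j k) :
    ∃ r, Cyc (f i.1.start) r (f i.1.finish) ∧ Cyc (f j.1.start) r (f j.1.finish) ∧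
      Cyc (f k.1.start) r (f k.1.finish) := by
  obtain ⟨q, h1, h2, h3⟩ := hM.2.exists_common hij hik hjk
  rw [CircleArc.mem_points, hf.sbtw_iff] at h1 h2 h3
  exact ⟨f q, h1, h2, h3⟩

theorem IsPHCA.not_wheelGraph (hM : M.IsPHCA) :
    ¬ (wheelGraph 4).IsIndContained M.intersectionGraph := by
  rintro ⟨φ⟩
  obtain ⟨f, hf⟩ := exists_isCoordinate (φ none).1.start
  have h := hM.1.properArcs hf
  have adj : ∀ x y, (wheelGraph 4).Adj x y → M.intersectionGraph.Adj (φ x) (φ y) :=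
    fun x y => φ.map_rel_iff.2
  have nadj : ∀ x y, ¬ (wheelGraph 4).Adj x y → ¬ M.intersectionGraph.Adj (φ x) (φ y) :=
    fun x y hxy h' => hxy (φ.map_rel_iff.1 h')
  refine h.false_of_wheel (u := φ none) (a := φ (some 0)) (b := φ (some 1)) (c := φ (some 2))
    (d := φ (some 3)) (fun i => by rw [hf.base]; exact hf.nonneg _) (fun i => ?_)
    (hM.helly_coordinates hf) ?_ ?_ ?_ ?_ ?_ ?_ ?_ ?_ ?_ ?_ (φ.injective.ne (by simp))
    (φ.injective.ne (by simp))
  · have h0 := hf.injective.ne (M.start_ne_finish (φ none).1 (φ none).2 i.1 i.2)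
    rw [hf.base] at h0 ⊢
    exact lt_of_le_of_ne (hf.nonneg _) h0
  all_goals first
    | exact adj _ _ (by simp [wheelGraph, cycleGraph_adj] <;> decide)
    | exact nadj _ _ (by simp [wheelGraph, cycleGraph_adj] <;> decide)

theorem IsPHCA.not_threeSun (hM : M.IsPHCA) : ¬ threeSun.IsIndContained M.intersectionGraph := by
  rintro ⟨φ⟩
  have ha : ∀ i j, i ≠ j → M.intersectionGraph.Adj (φ (.inl i)) (φ (.inl j)) := fun i j hij =>
    φ.map_rel_iff.2 (by simp [threeSun, hij, hij.symm])
  have hab : ∀ i j, i ≠ j → M.intersectionGraph.Adj (φ (.inl i)) (φ (.inr j)) := fun i j hij =>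
    φ.map_rel_iff.2 (by simp [threeSun, hij])
  have hab' : ∀ i, ¬ M.intersectionGraph.Adj (φ (.inl i)) (φ (.inr i)) := fun i h =>
    absurd (φ.map_rel_iff.1 h) (by simp [threeSun])
  obtain ⟨p, p0, p1, p2⟩ := hM.2.exists_common (ha 0 1 (by decide)) (ha 0 2 (by decide))
    (ha 1 2 (by decide))
  obtain ⟨f, hf⟩ := exists_isCoordinate p
  have h := hM.1.properArcs hf
  have hw : ∀ A : CircleArc M.length, p ∈ A.points → f A.finish < f A.start := by
    intro A hA
    rw [CircleArc.mem_points, hf.sbtw_iff, hf.base] at hA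
    have := hf.nonneg A.start
    have := hf.nonneg A.finish
    rcases hA with hA | hA | hA <;> linarith
  refine h.false_of_threeSun (a := fun i => φ (.inl i)) (b := fun i => φ (.inr i))
    (hM.helly_coordinates hf) (fun i => hw _ ?_) ha hab hab' fun i => φ.injective.ne (by simp)
  fin_cases i
  exacts [p0, p1, p2]

/-- The arcs `a i` cover the circle and any two of them, but not all three, have a common point. -/
def CoversTriply {L : ℝ} [Fact (0 < L)] (a : Fin 3 → CircleArc L) : Prop :=
  sbtw (a 0).start (a 2).finish (a 1).start ∧ sbtw (a 0).start (a 1).start (a 0).finish ∧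
  sbtw (a 0).start (a 0).finish (a 2).start ∧ sbtw (a 0).start (a 2).start (a 1).finish

/-- Being free of the cut, this form of a covering triple can be rotated until its universal member
comes first. -/
theorem CoversTriply.rotate {L : ℝ} [Fact (0 < L)] {a : Fin 3 → CircleArc L}
    (h : CoversTriply a) : CoversTriply ![a 1, a 2, a 0] := by
  obtain ⟨f, hf⟩ := exists_isCoordinate (a 0).start
  simp only [CoversTriply, hf.sbtw_iff] at *
  simp only [Cyc, hf.base] at *
  simp
  have := hf.nonneg (a 0).finish
  have := hf.nonneg (a 1).finish
  have := hf.nonneg (a 1).start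
  have := hf.nonneg (a 2).finish
  have := hf.nonneg (a 2).start
  have := hf.base
  clear hf
  grind -ring (splits := 40)

theorem isCoveringTriple_iff {p : AddCircle M.length} {f : AddCircle M.length → ℝ}
    (hf : IsCoordinate p f) {a : Fin 3 → M.arcs} (hp : (a 0).1.start = p) :
    IsCoveringTriple (fun A : M.arcs => f A.1.start) (fun A => f A.1.finish) a ↔
      CoversTriply fun i => (a i).1 := by
  have hpos : ∀ B : M.arcs, 0 < f B.1.finish := fun B => by
    have h0 := hf.injective.ne (M.start_ne_finish (a 0).1 (a 0).2 B.1 B.2)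
    rw [hp, hf.base] at h0
    exact lt_of_le_of_ne (hf.nonneg _) h0
  have h0 := hf.base
  have h1 := hf.nonneg
  rw [← hp] at h0
  have p0 := hpos (a 0)
  have p1 := hpos (a 1)
  have p2 := hpos (a 2)
  have q1 := h1 (a 1).1.start
  have q2 := h1 (a 2).1.start
  simp only [CoversTriply, hf.sbtw_iff, Cyc, h0]
  constructor
  · rintro ⟨-, -, h3, h4, h5, h6⟩
    grind -ring
  · rintro ⟨h3, h4, h5, h6⟩
    refine ⟨fun i => h0 ▸ h1 _, fun i => by rw [h0]; exact hpos i, ?_, ?_, ?_, ?_⟩ <;> grind -ring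

theorem IsProper.wheelGraph_or_threeSun (hM : M.IsProper) {a : Fin 3 → M.arcs}
    (ha : CoversTriply fun i => (a i).1)
    (hu : ∀ i j, i ≠ j → M.intersectionGraph.IsUniversal (a i) →
      ¬ M.intersectionGraph.IsUniversal (a j))
    (hcov : ∀ p, ∃ A : M.arcs, ¬ M.intersectionGraph.IsUniversal A ∧ p ∈ A.1.points) :
    (wheelGraph 4).IsIndContained M.intersectionGraph ∨
      threeSun.IsIndContained M.intersectionGraph := by
  have : Finite M.arcs := M.finite_arcs
  by_cases hnu : ∀ i, ¬ M.intersectionGraph.IsUniversal (a i)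
  · obtain ⟨f, hf⟩ := exists_isCoordinate (a 0).1.start
    exact (hM.properArcs hf).wheelGraph_or_threeSun_of_not_universal
      ((isCoveringTriple_iff hf rfl).2 ha) hnu
  obtain ⟨a', ha', hu0, hu1, hu2⟩ : ∃ a' : Fin 3 → M.arcs, (CoversTriply fun i => (a' i).1) ∧
      M.intersectionGraph.IsUniversal (a' 0) ∧ ¬ M.intersectionGraph.IsUniversal (a' 1) ∧
      ¬ M.intersectionGraph.IsUniversal (a' 2) := by
    push Not at hnu
    obtain ⟨i, hi⟩ := hnu
    have hn := fun j hij => hu i j hij hi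
    have hvec : ∀ x y z : M.arcs, (fun i => (![x, y, z] i).1) = ![x.1, y.1, z.1] := fun x y z => by
      ext i : 1
      fin_cases i <;> rfl
    fin_cases i
    · exact ⟨a, ha, hi, hn 1 (by decide), hn 2 (by decide)⟩
    · refine ⟨![a 1, a 2, a 0], ?_, hi, hn 2 (by decide), hn 0 (by decide)⟩
      rw [hvec]
      exact ha.rotate
    · refine ⟨![a 2, a 0, a 1], ?_, hi, hn 0 (by decide), hn 1 (by decide)⟩
      rw [hvec]
      exact ha.rotate.rotate
  obtain ⟨f, hf⟩ := exists_isCoordinate (a' 0).1.start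
  refine .inl ((hM.properArcs hf).wheelGraph_isIndContained_of_isUniversal
    ((isCoveringTriple_iff hf rfl).2 ha') hu0 hu1 hu2 fun i => ?_)
  obtain ⟨A, hA, hp⟩ := hcov i.1.finish
  exact ⟨A, hA, (hf.sbtw_iff _ _ _).1 hp⟩

theorem mem_universalArcs {A : M.arcs} :
    A.1 ∈ M.universalArcs ↔ M.intersectionGraph.IsUniversal A := by
  simp [universalArcs, universalVerts]

theorem finite_universalArcs (M : CircularArcModel) : M.universalArcs.Finite :=
  M.finite_arcs.subset (by rintro _ ⟨A, -, rfl⟩; exact A.2)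

theorem IsProper.submodel (hM : M.IsProper) (S : Set (CircleArc M.length)) :
    (M.submodel S).IsProper :=
  fun A hA B hB => hM A hA.1 B hB.1

theorem IsHelly.submodel (hM : M.IsHelly) (S : Set (CircleArc M.length)) :
    (M.submodel S).IsHelly :=
  fun F hF => hM F (hF.trans Set.inter_subset_left)

theorem IsPHCA.submodel (hM : M.IsPHCA) (S : Set (CircleArc M.length)) :
    (M.submodel S).IsPHCA :=
  ⟨hM.1.submodel S, hM.2.submodel S⟩

/-- If both alternatives fail, `U₁` has a clique `F` without a common point, while the non-universal
arcs cover the circle. Since `F` has at most one universal member, no two of its members cover the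
circle, and it contains a covering triple. -/
theorem IsProper.isHCA_or_isPIG (hM : M.IsProper) {M₁ M₀ : CircularArcModel} (h₁ : M.IsU 1 M₁)
    (h₀ : M.IsU 0 M₀) (hW : ¬ (wheelGraph 4).IsIndContained M.intersectionGraph)
    (hS : ¬ threeSun.IsIndContained M.intersectionGraph) : M₁.IsHCA ∨ M₀.IsPIG := by
  by_contra! hcon
  obtain ⟨hH, hI⟩ := hcon
  obtain ⟨K, hK, hcard, rfl⟩ := h₁
  obtain ⟨K₀, hK₀, hcard₀, rfl⟩ := h₀
  have hK1 : K.ncard ≤ 1 := hcard ▸ min_le_left _ _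
  have hK0 : K₀ = ∅ := by
    rw [zero_min, Set.ncard_eq_zero (M.finite_universalArcs.subset hK₀)] at hcard₀
    exact hcard₀
  subst hK0
  have hcov : ∀ p, ∃ A : M.arcs, ¬ M.intersectionGraph.IsUniversal A ∧ p ∈ A.1.points := by
    intro p
    by_contra! hp
    refine hI ⟨hM.submodel _, p, fun A hA => ?_⟩
    refine hp (⟨A, hA.1⟩ : M.arcs) fun hu => ?_
    have h' := hA.2
    rw [Set.union_empty] at h'
    exact h' ((mem_universalArcs (M := M) (A := ⟨A, hA.1⟩)).2 hu)
  change ¬ ∀ F : Set (CircleArc M.length), F ⊆ M.arcs ∩ (M.universalArcsᶜ ∪ K) →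
    (∀ A ∈ F, ∀ B ∈ F, A.Meets B) → ∃ p : AddCircle M.length, ∀ A ∈ F, p ∈ A.points at hH
  simp only [not_forall] at hH
  obtain ⟨F, hF, hFm, hFp⟩ := hH
  have hFM : F ⊆ M.arcs := hF.trans Set.inter_subset_left
  have huni : ∀ A B : M.arcs, A.1 ∈ F → B.1 ∈ F → A ≠ B → M.intersectionGraph.IsUniversal A →
      ¬ M.intersectionGraph.IsUniversal B := by
    intro A B hA hB hAB uA uB
    have key : ∀ A : M.arcs, A.1 ∈ F → M.intersectionGraph.IsUniversal A → A.1 ∈ K :=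
      fun A hA uA => (hF hA).2.resolve_left fun h => h (mem_universalArcs.2 uA)
    have := (Set.ncard_le_one (M.finite_universalArcs.subset hK)).1 hK1 _ (key A hA uA) _
      (key B hB uB)
    exact hAB (Subtype.ext this)
  obtain ⟨o, ho⟩ : F.Nonempty := by
    by_contra! hF0
    exact hFp ⟨0, by simp [hF0]⟩
  obtain ⟨f, hf⟩ := exists_isCoordinate o.start
  have h := hM.properArcs hf
  have : Finite M.arcs := M.finite_arcs
  obtain ⟨a, haF, ha⟩ := h.exists_isCoveringTriple (F := {A | A.1 ∈ F})
    (fun A hA B hB hAB => ⟨hAB, hFm _ hA _ hB⟩)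
    (fun A hA B hB hAB hc => huni A B hA hB hAB (h.isUniversal_left hAB hc.1 hc.2)
      (h.isUniversal_right hAB hc.1 hc.2))
    (by
      intro A hA
      by_contra! hcon
      refine hFp (CircleArc.exists_mem_points_of_start (M.finite_arcs.subset hFM)
        (M.start_ne_finish A.1 A.2 A.1 A.2) fun B hB hBA => ?_)
      exact (hf.sbtw_iff _ _ _).2 (hcon ⟨B, hFM hB⟩ hB fun e => hBA (e ▸ rfl)))
    (o := ⟨o, hFM ho⟩) ho (fun i => by rw [hf.base]; exact hf.nonneg _) (fun i => by
      have h0 := hf.injective.ne (M.start_ne_finish o (hFM ho) i.1 i.2)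
      rw [hf.base] at h0 ⊢
      exact lt_of_le_of_ne (hf.nonneg _) h0)
  have ha' : CoversTriply fun i => (a i).1 := by
    have e1 := ha.start_lt_finish (a 2)
    obtain ⟨-, -, h3, h4, h5, h6⟩ := ha
    simp only [CoversTriply, hf.sbtw_iff]
    simp only [Cyc]
    grind -ring
  have hne : ∀ i j, i ≠ j → a i ≠ a j := fun i j hij => (h.adj_triple ha i j hij).ne
  rcases hM.wheelGraph_or_threeSun ha' (fun i j hij => huni _ _ (haF i) (haF j) (hne i j hij))
    hcov with h' | h'
  exacts [hW h', hS h']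

end CircularArcModel

/-! ### Adding an arc to a model. -/

namespace CircularArcModel

variable {M : CircularArcModel}

/-- The set of the extremes of the arcs of a model. -/
def extremes (M : CircularArcModel) : Set (AddCircle M.length) :=
  CircleArc.start '' M.arcs ∪ CircleArc.finish '' M.arcs

theorem finite_extremes (M : CircularArcModel) : M.extremes.Finite :=
  (M.finite_arcs.image _).union (M.finite_arcs.image _)

theorem start_mem_extremes {A : CircleArc M.length} (hA : A ∈ M.arcs) : A.start ∈ M.extremes :=
  .inl ⟨A, hA, rfl⟩

theorem finish_mem_extremes {A : CircleArc M.length} (hA : A ∈ M.arcs) : A.finish ∈ M.extremes :=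
  .inr ⟨A, hA, rfl⟩

/-- The extremes of `A` are distinct from each other and from the extremes of the model. -/
structure IsNewArc (M : CircularArcModel) (A : CircleArc M.length) : Prop where
  start_ne_finish : A.start ≠ A.finish
  start_notMem : A.start ∉ M.extremes
  finish_notMem : A.finish ∉ M.extremes

namespace IsNewArc

variable {A B : CircleArc M.length} (hA : M.IsNewArc A)
include hA

theorem start_ne_start (hB : B ∈ M.arcs) : A.start ≠ B.start :=
  fun h => hA.start_notMem (h ▸ start_mem_extremes hB)

theorem start_ne_finish' (hB : B ∈ M.arcs) : A.start ≠ B.finish :=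
  fun h => hA.start_notMem (h ▸ finish_mem_extremes hB)

theorem finish_ne_start (hB : B ∈ M.arcs) : B.start ≠ A.finish :=
  fun h => hA.finish_notMem (h ▸ start_mem_extremes hB)

theorem finish_ne_finish (hB : B ∈ M.arcs) : A.finish ≠ B.finish :=
  fun h => hA.finish_notMem (h ▸ finish_mem_extremes hB)

theorem notMem : A ∉ M.arcs := fun h => hA.start_ne_start h rfl

theorem meets_iff (hB : B ∈ M.arcs) :
    A.Meets B ↔ sbtw A.start B.start A.finish ∨ sbtw B.start A.start B.finish :=
  CircleArc.meets_iff hA.start_ne_finish (M.start_ne_finish B hB B hB) (hA.start_ne_start hB)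
    (hA.start_ne_finish' hB) (hA.finish_ne_start hB)

theorem points_subset_iff (hB : B ∈ M.arcs) :
    A.points ⊆ B.points ↔ sbtw B.start A.start B.finish ∧ sbtw B.start A.finish B.finish ∧
      ¬ sbtw A.start B.finish A.finish :=
  CircleArc.points_subset_iff hA.start_ne_finish (hA.start_ne_start hB)
    (hA.start_ne_finish' hB) (hA.finish_ne_start hB) (hA.finish_ne_finish hB)

theorem subset_points_iff (hB : B ∈ M.arcs) :
    B.points ⊆ A.points ↔ sbtw A.start B.start A.finish ∧ sbtw A.start B.finish A.finish ∧
      ¬ sbtw B.start A.finish B.finish :=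
  CircleArc.points_subset_iff (M.start_ne_finish B hB B hB) (hA.start_ne_start hB).symm
    (hA.finish_ne_start hB) (hA.start_ne_finish' hB) (hA.finish_ne_finish hB).symm

end IsNewArc

/-- The model obtained by adding an arc. -/
def insertArc (M : CircularArcModel) {A : CircleArc M.length} (hA : M.IsNewArc A) :
    CircularArcModel where
  length := M.length
  arcs := insert A M.arcs
  finite_arcs := M.finite_arcs.insert A
  start_ne_finish := by
    rintro B (rfl | hB) C (rfl | hC)
    exacts [hA.start_ne_finish, hA.start_ne_finish' hC, hA.finish_ne_start hB,
      M.start_ne_finish B hB C hC]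
  start_ne_start := by
    rintro B (rfl | hB) C (rfl | hC) h
    exacts [absurd rfl h, hA.start_ne_start hC, (hA.start_ne_start hB).symm,
      M.start_ne_start B hB C hC h]
  finish_ne_finish := by
    rintro B (rfl | hB) C (rfl | hC) h
    exacts [absurd rfl h, hA.finish_ne_finish hC, (hA.finish_ne_finish hB).symm,
      M.finish_ne_finish B hB C hC h]

theorem IsProper.insertArc (hM : M.IsProper) {A : CircleArc M.length} (hA : M.IsNewArc A)
    (h : ∀ B ∈ M.arcs, ¬ A.points ⊆ B.points ∧ ¬ B.points ⊆ A.points) :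
    (M.insertArc hA).IsProper := by
  change ∀ B ∈ insert A M.arcs, ∀ C ∈ insert A M.arcs, B ≠ C → ¬ B.points ⊆ C.points
  rintro B (rfl | hB) C (rfl | hC) hBC
  exacts [absurd rfl hBC, (h C hC).1, (h B hB).2, hM B hB C hC hBC]

/-- A nonempty family with a common point contains an arc that begins in all the others. -/
theorem exists_start_mem_of_common {F : Set (CircleArc M.length)} (hF : F ⊆ M.arcs)
    (hne : F.Nonempty) {p : AddCircle M.length} (hp : ∀ A ∈ F, p ∈ A.points) :
    ∃ A ∈ F, ∀ B ∈ F, B ≠ A → A.start ∈ B.points := by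
  obtain ⟨f, hf⟩ := exists_isCoordinate p
  obtain ⟨A, hA, hmax⟩ := Set.exists_max_image F (fun A => f A.start) (M.finite_arcs.subset hF) hne
  refine ⟨A, hA, fun B hB hBA => ?_⟩
  have h1 := hp B hB
  have h2 := lt_of_le_of_ne (hmax B hB)
    (hf.injective.ne (M.start_ne_start B (hF hB) A (hF hA) hBA))
  have h3 := hf.nonneg B.start
  have h4 := hf.nonneg B.finish
  rw [CircleArc.mem_points, hf.sbtw_iff] at *
  rw [hf.base] at h1
  refine .inr (.inr ⟨?_, h2⟩)
  rcases h1 with h1 | h1 | h1 <;> linarith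

/-- An arc can be doubled, by a slight shift. -/
theorem IsPHCA.exists_twin (hM : M.IsPHCA) {A : CircleArc M.length} (hA : A ∈ M.arcs) :
    ∃ (A' : CircleArc M.length) (hA' : M.IsNewArc A'), (M.insertArc hA').IsPHCA ∧
      A'.Meets A ∧ ∀ B ∈ M.arcs, B ≠ A → (A'.Meets B ↔ A.Meets B) := by
  -- Both extremes of `A` move forward past no other extreme, so the twin has the same position as
  -- `A` relative to every other arc.
  obtain ⟨a, ha, haP, ha'⟩ := exists_sbtw_right M.extremes M.finite_extremes A.start
  obtain ⟨b, hb, hbP, hb'⟩ := exists_sbtw_right M.extremes M.finite_extremes A.finish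
  have hAA := M.start_ne_finish A hA A hA
  have hA1 := ha' _ (finish_mem_extremes hA) hAA.symm
  have hA2 := hb' _ (start_mem_extremes hA) hAA
  obtain ⟨f, hf⟩ := exists_isCoordinate A.start
  have hpos : ∀ x, x ≠ A.start → 0 < f x := fun x hx =>
    lt_of_le_of_ne (hf.nonneg x) fun h => hx (hf.injective (h.symm.trans hf.base.symm))
  have c1 : 0 < f a := hpos a ha
  have c2 : f a < f A.finish := by
    rw [hf.sbtw_iff, hf.base] at hA1
    have := hf.nonneg A.finish
    rcases hA1 with h | h | h <;> linarith
  have c3 : f A.finish < f b := by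
    rw [hf.sbtw_iff, hf.base] at hA2
    have := hf.nonneg b
    rcases hA2 with h | h | h <;> linarith
  have hab : a ≠ b := by
    rintro rfl
    linarith
  have hnew : M.IsNewArc ⟨a, b⟩ := ⟨hab, haP, hbP⟩
  have hord : ∀ x ∈ M.extremes, x ≠ A.start → x ≠ A.finish →
      f a < f x ∧ (f x < f A.finish ∨ f b < f x) := by
    intro x hx hxs hxt
    have h1 := ha' x hx hxs
    have h2 := hb' x hx hxt
    have h3 := hpos x hxs
    rw [hf.sbtw_iff, hf.base] at h1
    rw [hf.sbtw_iff] at h2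
    constructor
    · rcases h1 with h | h | h <;> linarith
    · rcases h2 with h | h | h
      · exact .inr h.2
      · linarith
      · exact .inl h.1
  have hords : ∀ B ∈ M.arcs, B ≠ A →
      (f a < f B.start ∧ (f B.start < f A.finish ∨ f b < f B.start)) ∧
      (f a < f B.finish ∧ (f B.finish < f A.finish ∨ f b < f B.finish)) ∧
      f B.start ≠ f B.finish := fun B hB hBA =>
    ⟨hord _ (start_mem_extremes hB) (M.start_ne_start B hB A hA hBA)
      (M.start_ne_finish B hB A hA),
    hord _ (finish_mem_extremes hB) (M.start_ne_finish A hA B hB).symm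
      (M.finish_ne_finish B hB A hA hBA), hf.injective.ne (M.start_ne_finish B hB B hB)⟩
  have hself : (⟨a, b⟩ : CircleArc M.length).Meets A := by
    rw [hnew.meets_iff hA]
    exact .inr hA1
  have hmeet : ∀ B ∈ M.arcs, B ≠ A →
      ((⟨a, b⟩ : CircleArc M.length).Meets B ↔ A.Meets B) := by
    intro B hBM hBA
    obtain ⟨h1, h2, h3⟩ := hords B hBM hBA
    rw [hnew.meets_iff hBM, meets_iff hA hBM hBA.symm]
    simp only [hf.sbtw_iff, Cyc, hf.base]
    clear hords hord ha' hb' hpos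
    grind -ring (splits := 40)
  refine ⟨⟨a, b⟩, hnew, ⟨hM.1.insertArc hnew fun B hBM => ?_, ?_⟩, hself, hmeet⟩
  · rw [hnew.points_subset_iff hBM, hnew.subset_points_iff hBM]
    by_cases hBA : B = A
    · subst hBA
      simp only [hf.sbtw_iff, Cyc, hf.base]
      clear hords hord ha' hb' hpos
      grind -ring (splits := 40)
    · obtain ⟨h1, h2, h3⟩ := hords B hBM hBA
      have h4 := hM.1 A hA B hBM (Ne.symm hBA)
      have h5 := hM.1 B hBM A hA hBA
      rw [points_subset_iff hA hBM (Ne.symm hBA)] at h4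
      rw [points_subset_iff hBM hA hBA] at h5
      simp only [hf.sbtw_iff, Cyc, hf.base] at h4 h5 ⊢
      clear hords hord ha' hb' hpos
      constructor
      · clear h5
        grind -ring (splits := 40)
      · clear h4
        grind -ring (splits := 40)
  · change ∀ F : Set (CircleArc M.length), F ⊆ insert ⟨a, b⟩ M.arcs →
      (∀ B ∈ F, ∀ C ∈ F, B.Meets C) → ∃ p : AddCircle M.length, ∀ B ∈ F, p ∈ B.points
    intro F hF hFm
    by_cases hmem : (⟨a, b⟩ : CircleArc M.length) ∈ F
    swap
    · exact hM.2 F (fun B hB => (hF hB).resolve_left fun e => hmem (e ▸ hB)) hFm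
    -- The twin is replaced by `A` itself, so that the Helly property of `M` applies.
    set F' : Set (CircleArc M.length) := insert A (F \ {⟨a, b⟩}) with hF'
    have hF'M : F' ⊆ M.arcs := by
      rintro B (rfl | hB)
      exacts [hA, (hF hB.1).resolve_left hB.2]
    have hAm : ∀ B ∈ F', A.Meets B := by
      intro B hB
      by_cases hBA : B = A
      · rw [hBA]
        exact CircleArc.meets_self hAA
      · exact (hmeet B (hF'M hB) hBA).1 (hFm _ hmem _ (hB.resolve_left hBA).1)
    have hsymm : ∀ B C : CircleArc M.length, B.Meets C → C.Meets B := fun B C h => by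
      rwa [CircleArc.Meets, Set.inter_comm] at h
    obtain ⟨p, hp⟩ := hM.2 F' hF'M (by
      rintro B (rfl | hB) C hC
      · exact hAm C hC
      · rcases hC with rfl | hC
        · exact hsymm _ _ (hAm B (.inr hB))
        · exact hFm B hB.1 C hC.1)
    obtain ⟨C, hC, hC'⟩ := exists_start_mem_of_common hF'M ⟨A, .inl rfl⟩ hp
    have hFfin : F.Finite := (M.finite_arcs.insert _).subset hF
    by_cases hCA : C = A
    · subst hCA
      -- When `A` is the arc that begins in all the others, its twin takes over that role, whether
      -- or not `A` belongs to `F`.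
      refine CircleArc.exists_mem_points_of_start hFfin (A := ⟨a, b⟩) hab fun B hBF hBa => ?_
      by_cases hBA : B = C
      · subst hBA
        exact hA1
      · have hBF' : B ∈ F' := .inr ⟨hBF, hBa⟩
        obtain ⟨h1, h2, h3⟩ := hords B (hF'M hBF') hBA
        have h4 := hC' B hBF' hBA
        rw [CircleArc.mem_points] at h4 ⊢
        simp only [hf.sbtw_iff, Cyc, hf.base] at h4 ⊢
        clear hords hord ha' hb' hpos
        grind -ring (splits := 40)
    · refine CircleArc.exists_mem_points_of_start hFfin (A := C)
        (M.start_ne_finish C (hF'M hC) C (hF'M hC)) fun B hBF hBC => ?_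
      by_cases hBa : B = ⟨a, b⟩
      · subst hBa
        obtain ⟨h1, h2, h3⟩ := hords C (hF'M hC) hCA
        have h4 := hC' A (.inl rfl) (Ne.symm hCA)
        rw [CircleArc.mem_points] at h4 ⊢
        simp only [hf.sbtw_iff, Cyc, hf.base] at h4 ⊢
        clear hords hord ha' hb' hpos
        grind -ring (splits := 40)
      · exact hC' B (.inr ⟨hBF, hBa⟩) hBC

theorem IsInterval.exists_coordinate (hM : M.IsInterval) :
    ∃ p f, IsCoordinate p f ∧ ∀ A ∈ M.arcs, f A.start < f A.finish := by
  -- An arc ending at the cut would have its end at coordinate `0`, before its beginning; so an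
  -- uncovered end is replaced by a point just after it.
  obtain ⟨p, hp, hpf⟩ : ∃ p : AddCircle M.length, (∀ A ∈ M.arcs, p ∉ A.points) ∧
      ∀ A ∈ M.arcs, A.finish ≠ p := by
    obtain ⟨p, hp⟩ := hM
    by_cases hpf : ∀ A ∈ M.arcs, A.finish ≠ p
    · exact ⟨p, hp, hpf⟩
    push Not at hpf
    obtain ⟨B, hB, rfl⟩ := hpf
    obtain ⟨q, hq, hqP, hq'⟩ := exists_sbtw_right M.extremes M.finite_extremes B.finish
    refine ⟨q, fun A hA hqA => ?_, fun A hA h => hqP (h ▸ finish_mem_extremes hA)⟩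
    have h1 := hq' _ (start_mem_extremes hA) (M.start_ne_finish A hA B hB)
    have h2 := hp A hA
    rw [CircleArc.mem_points] at hqA h2
    by_cases hAB : A.finish = B.finish
    · rw [hAB] at hqA
      exact sbtw_asymm h1 hqA.cyclic_left.cyclic_left.cyclic_left |>.elim
    · have h3 := hq' _ (finish_mem_extremes hA) hAB
      obtain ⟨f, hf⟩ := exists_isCoordinate B.finish
      simp only [hf.sbtw_iff, Cyc] at *
      clear hq'
      grind -ring (splits := 40)
  obtain ⟨f, hf⟩ := exists_isCoordinate p
  refine ⟨p, f, hf, fun A hA => ?_⟩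
  have h1 := hp A hA
  have h2 := hf.injective.ne (hpf A hA)
  have h3 := hf.nonneg A.finish
  have h4 := hf.injective.ne (M.start_ne_finish A hA A hA)
  rw [CircleArc.mem_points, hf.sbtw_iff] at h1
  rw [hf.base] at h1 h2
  simp only [Cyc] at h1
  grind -ring

/-- One-dimensional Helly theorem. -/
theorem isHelly_of_coordinate {p : AddCircle M.length} {f : AddCircle M.length → ℝ}
    (hf : IsCoordinate p f) (h : ∀ A ∈ M.arcs, f A.start < f A.finish) : M.IsHelly := by
  intro F hF hFm
  rcases F.eq_empty_or_nonempty with rfl | hne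
  · exact ⟨p, by simp⟩
  obtain ⟨A, hA, hmax⟩ := Set.exists_max_image F (fun A => f A.start) (M.finite_arcs.subset hF) hne
  refine CircleArc.exists_mem_points_of_start (M.finite_arcs.subset hF)
    (M.start_ne_finish A (hF hA) A (hF hA)) fun B hB hBA => ?_
  have h1 := (meets_iff (hF hB) (hF hA) hBA).1 (hFm B hB A hA)
  have h2 := lt_of_le_of_ne (hmax B hB)
    (hf.injective.ne (M.start_ne_start B (hF hB) A (hF hA) hBA))
  have h3 := h A (hF hA)
  have h4 := h B (hF hB)
  rw [CircleArc.mem_points]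
  simp only [hf.sbtw_iff, Cyc] at *
  clear hmax h
  grind -ring

theorem IsPIG.isPHCA (hM : M.IsPIG) : M.IsPHCA := by
  obtain ⟨p, f, hf, h⟩ := hM.2.exists_coordinate
  exact ⟨hM.1, isHelly_of_coordinate hf h⟩

/-- A universal arc can be added to a proper interval model without universal arcs and without
three pairwise disjoint arcs. -/
theorem IsPIG.exists_insert_universal (hM : M.IsPIG) (hne : M.arcs.Nonempty)
    (hnu : ∀ B ∈ M.arcs, ∃ C ∈ M.arcs, B ≠ C ∧ ¬ B.Meets C)
    (hclaw : ∀ B ∈ M.arcs, ∀ C ∈ M.arcs, ∀ D ∈ M.arcs, B ≠ C → B ≠ D → C ≠ D → ¬ B.Meets C →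
      ¬ B.Meets D → ¬ C.Meets D → False) :
    ∃ (A : CircleArc M.length) (hA : M.IsNewArc A), (M.insertArc hA).IsPHCA ∧
      ∀ B ∈ M.arcs, A.Meets B := by
  obtain ⟨p, f, hf, h⟩ := hM.2.exists_coordinate
  obtain ⟨I, hI, hmin⟩ := Set.exists_min_image M.arcs (fun A => f A.finish) M.finite_arcs hne
  obtain ⟨J, hJ, hmax⟩ := Set.exists_max_image M.arcs (fun A => f A.start) M.finite_arcs hne
  have hdisj : ∀ B ∈ M.arcs, ∀ C ∈ M.arcs, f B.finish < f C.start → B ≠ C ∧ ¬ B.Meets C := by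
    intro B hB C hC hBC
    have h1 := h B hB
    have h2 := h C hC
    have h3 : B ≠ C := by
      rintro rfl
      linarith
    refine ⟨h3, ?_⟩
    rw [meets_iff hB hC h3, hf.sbtw_iff, hf.sbtw_iff]
    rintro ((h4 | h4 | h4) | (h4 | h4 | h4)) <;> linarith
  have hmeets : ∀ B ∈ M.arcs, ∀ C ∈ M.arcs, f B.start < f C.finish → f C.start < f B.finish →
      B ≠ C → B.Meets C := by
    intro B hB C hC h1 h2 h3
    have h4 := hf.injective.ne (M.start_ne_start B hB C hC h3)
    rw [meets_iff hB hC h3, hf.sbtw_iff, hf.sbtw_iff]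
    rcases lt_or_gt_of_ne h4 with h4 | h4
    · exact .inl (.inl ⟨h4, h2⟩)
    · exact .inr (.inl ⟨h4, h1⟩)
  -- The new arc runs from just inside the first end, that of `I`, to just inside the last
  -- beginning, that of `J`; this suffices to meet every arc.
  obtain ⟨a, ha, haP, ha'⟩ := exists_sbtw_left M.extremes M.finite_extremes I.finish
  obtain ⟨b, hb, hbP, hb'⟩ := exists_sbtw_right M.extremes M.finite_extremes J.start
  have hIw := h I hI
  have hJw := h J hJ
  have hIJ : f I.finish < f J.start := by
    obtain ⟨C, hC, hIC, hn⟩ := hnu I hI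
    have h1 := hmin C hC
    have h2 := hmax C hC
    have h3 := hf.injective.ne (M.start_ne_finish J hJ I hI)
    have h4 := h C hC
    by_contra h5
    have h6 : f J.start < f I.finish := lt_of_le_of_ne (not_lt.1 h5) h3
    exact hn (hmeets I hI C hC (by linarith) (by linarith) hIC)
  have a1 : f I.start < f a ∧ f a < f I.finish := by
    have := ha' _ (start_mem_extremes hI) (M.start_ne_finish I hI I hI)
    rw [hf.sbtw_iff] at this
    rcases this with h' | h' | h'
    · exact h'
    all_goals linarith
  have b1 : f J.start < f b ∧ f b < f J.finish := by
    have := hb' _ (finish_mem_extremes hJ) (M.start_ne_finish J hJ J hJ).symm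
    rw [hf.sbtw_iff] at this
    rcases this with h' | h' | h'
    · exact h'
    all_goals linarith
  have hao : ∀ x ∈ M.extremes, f a < f x → f I.finish ≤ f x := by
    intro x hx hax
    by_contra hlt
    have := ha' x hx (by rintro rfl; linarith)
    rw [hf.sbtw_iff] at this
    rcases this with h' | h' | h' <;> linarith
  have hbo : ∀ x ∈ M.extremes, f x < f b → f x ≤ f J.start := by
    intro x hx hax
    by_contra hlt
    have := hb' x hx (by rintro rfl; linarith)
    rw [hf.sbtw_iff] at this
    rcases this with h' | h' | h' <;> linarith
  have hab : a ≠ b := by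
    rintro rfl
    linarith
  have hnew : M.IsNewArc ⟨a, b⟩ := ⟨hab, haP, hbP⟩
  refine ⟨⟨a, b⟩, hnew, ⟨hM.1.insertArc hnew fun B hB => ⟨?_, ?_⟩, ?_⟩, fun B hB => ?_⟩
  -- An arc containing the new one would be universal.
  · rw [hnew.points_subset_iff hB]
    simp only [hf.sbtw_iff]
    rintro ⟨h1, h2, -⟩
    have hw := h B hB
    obtain ⟨C, hC, hBC, hn⟩ := hnu B hB
    have h3 := hmin C hC
    have h4 := hmax C hC
    refine hn (hmeets B hB C hC ?_ ?_ hBC)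
    · rcases h1 with h1 | h1 | h1 <;> linarith
    · rcases h2 with h2 | h2 | h2 <;> linarith
  -- An arc inside the new one would lie strictly between `I` and `J`, giving three pairwise
  -- disjoint arcs.
  · rw [hnew.subset_points_iff hB]
    simp only [hf.sbtw_iff]
    rintro ⟨h1, h2, -⟩
    have hw := h B hB
    have h3 : f a < f B.start := by rcases h1 with h1 | h1 | h1 <;> linarith
    have h4 : f B.finish < f b := by rcases h2 with h2 | h2 | h2 <;> linarith
    have h5 := lt_of_le_of_ne (hao _ (start_mem_extremes hB) h3)
      (hf.injective.ne (M.start_ne_finish B hB I hI).symm)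
    have h6 := lt_of_le_of_ne (hbo _ (finish_mem_extremes hB) h4)
      (hf.injective.ne (M.start_ne_finish J hJ B hB).symm)
    obtain ⟨n1, m1⟩ := hdisj I hI B hB h5
    obtain ⟨n2, m2⟩ := hdisj B hB J hJ h6
    obtain ⟨n3, m3⟩ := hdisj I hI J hJ hIJ
    exact hclaw I hI B hB J hJ n1 n3 n2 m1 m3 m2
  · refine isHelly_of_coordinate (M := M.insertArc hnew) hf ?_
    rintro B (rfl | hB)
    · change f a < f b
      linarith
    · exact h B hB
  · rw [hnew.meets_iff hB]
    simp only [hf.sbtw_iff]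
    have h1 := hmin B hB
    have h2 := hmax B hB
    rcases lt_or_gt_of_ne (hf.injective.ne (hnew.start_ne_start hB)) with h3 | h3
    · exact .inl (.inl ⟨h3, by linarith⟩)
    · exact .inr (.inl ⟨h3, by linarith⟩)

end CircularArcModel

/-! ### Submodels as induced subgraphs, and restoring universal vertices. -/

namespace CircularArcModel

variable {M : CircularArcModel} {V : Type*} {G : SimpleGraph V}

theorem submodel_range_isModelOf (φ : G ↪g M.intersectionGraph) :
    (M.submodel (Set.range fun v => (φ v).1)).IsModelOf G := by
  let g : V → (M.submodel (Set.range fun v => (φ v).1)).arcs :=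
    fun v => ⟨(φ v).1, (φ v).2, v, rfl⟩
  have hg : Function.Bijective g := by
    constructor
    · intro v w h
      have h' : (φ v).1 = (φ w).1 := congrArg (fun C => C.1) h
      exact φ.injective (Subtype.ext h')
    · rintro ⟨_, h, v, rfl⟩
      exact ⟨v, rfl⟩
  refine ⟨⟨Equiv.ofBijective g hg, fun {v w} => ?_⟩⟩
  rw [← φ.map_adj_iff]
  refine and_congr_left' (not_congr (hg.1.eq_iff.trans φ.injective.eq_iff.symm))

/-- The intersection graph of a submodel is an induced subgraph. -/
def submodelEmbedding (M : CircularArcModel) (S : Set (CircleArc M.length)) :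
    (M.submodel S).intersectionGraph ↪g M.intersectionGraph where
  toFun A := ⟨A.1, A.2.1⟩
  inj' _ _ h := Subtype.ext (congrArg (fun C : M.arcs => C.1) h)
  map_rel_iff' := and_congr_left' (not_congr
    ⟨fun h => Subtype.ext (congrArg (fun C : M.arcs => C.1) h), fun h => congrArg _ h⟩)

theorem hasInducedSubmodelOf_iff :
    M.HasInducedSubmodelOf G ↔ G.IsIndContained M.intersectionGraph :=
  ⟨fun ⟨S, ⟨φ⟩⟩ => ⟨φ.toEmbedding.trans (M.submodelEmbedding S)⟩,
    fun ⟨φ⟩ => ⟨_, submodel_range_isModelOf φ⟩⟩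

theorem IsPHCA.isPHCAGraph (hM : M.IsPHCA) (φ : G ↪g M.intersectionGraph) : IsPHCAGraph G :=
  ⟨_, hM.submodel _, submodel_range_isModelOf φ⟩

theorem isPHCAGraph_induce_insert {S : Set V} {w : V} (φ : G.induce S ↪g M.intersectionGraph)
    {A : CircleArc M.length} (hA : M.IsNewArc A) (hM : (M.insertArc hA).IsPHCA)
    (h : ∀ x : S, A.Meets (φ x).1 ↔ G.Adj w x) : IsPHCAGraph (G.induce (insert w S)) := by
  classical
  let g : ↥(insert w S) → (M.insertArc hA).arcs := fun x =>
    if hx : x.1 ∈ S then ⟨(φ ⟨x.1, hx⟩).1, .inr (φ ⟨x.1, hx⟩).2⟩ else ⟨A, .inl rfl⟩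
  have hg : ∀ (x : ↥(insert w S)) (hx : x.1 ∈ S),
      g x = ⟨(φ ⟨x.1, hx⟩).1, .inr (φ ⟨x.1, hx⟩).2⟩ := fun x hx => dif_pos hx
  have hg' : ∀ x : ↥(insert w S), x.1 ∉ S → g x = ⟨A, .inl rfl⟩ := fun x hx => dif_neg hx
  have hne : ∀ x, (φ x).1 ≠ A := fun x hx => hA.notMem (hx ▸ (φ x).2)
  have hinj : Function.Injective g := by
    intro x y hxy
    by_cases hx : x.1 ∈ S <;> by_cases hy : y.1 ∈ S
    · rw [hg x hx, hg y hy] at hxy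
      have h' : (φ ⟨x.1, hx⟩).1 = (φ ⟨y.1, hy⟩).1 := congrArg (fun C => C.1) hxy
      have := φ.injective (Subtype.ext h')
      exact Subtype.ext (Subtype.mk.inj this)
    · rw [hg x hx, hg' y hy] at hxy
      exact absurd (congrArg Subtype.val hxy) (hne _)
    · rw [hg' x hx, hg y hy] at hxy
      exact absurd (congrArg Subtype.val hxy).symm (hne _)
    · exact Subtype.ext ((x.2.resolve_right hx).trans (y.2.resolve_right hy).symm)
  have hsymm : ∀ B C : CircleArc M.length, B.Meets C ↔ C.Meets B := fun B C => by
    rw [CircleArc.Meets, Set.inter_comm]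
    rfl
  refine hM.isPHCAGraph ⟨⟨g, hinj⟩, fun {x y} => ?_⟩
  change (g x ≠ g y ∧ (g x).1.Meets (g y).1) ↔ G.Adj x y
  by_cases hxy : x = y
  · subst hxy
    simp
  rw [and_iff_right (hinj.ne hxy)]
  by_cases hx : x.1 ∈ S <;> by_cases hy : y.1 ∈ S
  · rw [hg x hx, hg y hy]
    have h1 := φ.map_adj_iff (v := ⟨x.1, hx⟩) (w := ⟨y.1, hy⟩)
    rw [comap_adj] at h1
    refine Iff.trans ?_ h1
    exact ⟨fun h => ⟨φ.injective.ne fun e => hxy (Subtype.ext (Subtype.mk.inj e)), h⟩,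
      fun h => h.2⟩
  · rw [hg x hx, hg' y hy, y.2.resolve_right hy, G.adj_comm]
    exact (hsymm _ _).trans (h ⟨x.1, hx⟩)
  · rw [hg' x hx, hg y hy, x.2.resolve_right hx]
    exact h ⟨y.1, hy⟩
  · exact absurd (Subtype.ext ((x.2.resolve_right hx).trans (y.2.resolve_right hy).symm)) hxy

end CircularArcModel

open CircularArcModel

section

variable {V : Type*} {G : SimpleGraph V}

theorem IsPHCAGraph.induce_insert_universal {S : Set V} (h : IsPHCAGraph (G.induce S)) {u w : V}
    (hu : u ∈ S) (hw : w ∉ S) (hu' : G.IsUniversal u) (hw' : G.IsUniversal w) :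
    IsPHCAGraph (G.induce (insert w S)) := by
  obtain ⟨N, hN, ⟨φ⟩⟩ := h
  obtain ⟨A, hA, hAN, hAm, hA'⟩ := hN.exists_twin (φ ⟨u, hu⟩).2
  refine isPHCAGraph_induce_insert φ.toEmbedding hA hAN fun x => ?_
  refine iff_of_true ?_ (hw' fun e => hw (e ▸ x.2))
  by_cases hx : x = ⟨u, hu⟩
  · subst hx
    exact hAm
  · refine (hA' _ (φ x).2 fun e => hx (φ.injective (Subtype.ext e))).2 ?_
    have hadj : (G.induce S).Adj ⟨u, hu⟩ x := hu' fun e => hx (Subtype.ext e.symm)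
    exact (φ.map_adj_iff.2 hadj).2

theorem IsPHCAGraph.of_iso {W : Type*} {H : SimpleGraph W} (h : IsPHCAGraph H) (φ : G ≃g H) :
    IsPHCAGraph G := by
  obtain ⟨N, hN, ⟨ψ⟩⟩ := h
  exact ⟨N, hN, ⟨φ.trans ψ⟩⟩

/-- The missing vertices return one at a time, each represented by a twin of the arc of `u`. -/
theorem IsPHCAGraph.of_induce [Finite V] {S : Set V} (h : IsPHCAGraph (G.induce S))
    (hS : S = Set.univ ∨ (∃ u ∈ S, G.IsUniversal u) ∧ ∀ v ∉ S, G.IsUniversal v) :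
    IsPHCAGraph G := by
  suffices IsPHCAGraph (G.induce Set.univ) from this.of_iso (induceUnivIso G).symm
  rcases hS with rfl | ⟨⟨u, hu, hu'⟩, hS⟩
  · exact h
  have key : ∀ T : Set V, T.Finite → (∀ v ∈ T, G.IsUniversal v) →
      IsPHCAGraph (G.induce (S ∪ T)) := by
    intro T hT
    induction T, hT using Set.Finite.induction_on with
    | empty =>
      intro _
      rwa [Set.union_empty]
    | @insert w T hw hT ih =>
      intro hT'
      have ih := ih fun v hv => hT' v (.inr hv)
      rw [Set.union_insert]
      by_cases hwS : w ∈ S ∪ T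
      · rwa [Set.insert_eq_of_mem hwS]
      · exact ih.induce_insert_universal (.inl hu) hwS hu' (hT' w (.inl rfl))
  have := key Sᶜ (Set.toFinite _) hS
  rwa [Set.union_compl_self] at this

end

/-! ### (iii) → (i) and the conclusion. -/

namespace CircularArcModel

variable {M : CircularArcModel}

/-- The intersection graph of a submodel, as an induced subgraph. -/
def induceEmbedding (M : CircularArcModel) (S : Set (CircleArc M.length)) :
    M.intersectionGraph.induce {A | A.1 ∈ S} ↪g (M.submodel S).intersectionGraph where
  toFun A := ⟨A.1.1, A.1.2, A.2⟩
  inj' _ _ h := Subtype.ext (Subtype.ext (congrArg (fun C : (M.submodel S).arcs => C.1) h))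
  map_rel_iff' := and_congr_left' (not_congr
    ⟨fun h => Subtype.ext (congrArg (fun C : (M.submodel S).arcs => C.1) h),
      fun h => Subtype.ext (congrArg (fun C : M.arcs => C.1) h)⟩)

theorem isPHCAGraph_of_isHCA (hM : M.IsProper) {M₁ : CircularArcModel} (h₁ : M.IsU 1 M₁)
    (hH : M₁.IsHCA) : IsPHCAGraph M.intersectionGraph := by
  have : Finite M.arcs := M.finite_arcs
  obtain ⟨K, hK, hcard, rfl⟩ := h₁
  refine IsPHCAGraph.of_induce (IsPHCA.isPHCAGraph ⟨hM.submodel _, hH⟩ (M.induceEmbedding _)) ?_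
  rcases M.universalArcs.eq_empty_or_nonempty with he | hne
  · left
    ext A
    simp [he]
  · right
    rw [min_eq_left ((Set.ncard_pos M.finite_universalArcs).2 hne)] at hcard
    obtain ⟨A, rfl⟩ := Set.ncard_eq_one.1 hcard
    obtain ⟨A, hA, rfl⟩ := hK rfl
    refine ⟨⟨A, .inr rfl, hA⟩, fun B hB => mem_universalArcs.1 ?_⟩
    by_contra h
    exact hB (.inl h)

/-- No universal arc is left to be doubled, so one is inserted into the interval model first. Three
disjoint arcs there would form a claw with a universal arc of `M`. -/
theorem isPHCAGraph_of_isPIG (hM : M.IsProper) {M₀ : CircularArcModel} (h₀ : M.IsU 0 M₀)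
    (hI : M₀.IsPIG) : IsPHCAGraph M.intersectionGraph := by
  have : Finite M.arcs := M.finite_arcs
  obtain ⟨K, hK, hcard, rfl⟩ := h₀
  have hK0 : K = ∅ := by
    rw [zero_min, Set.ncard_eq_zero (M.finite_universalArcs.subset hK)] at hcard
    exact hcard
  subst hK0
  rw [Set.union_empty] at hI
  have hS : ∀ A : M.arcs, A.1 ∈ M.universalArcsᶜ ↔ ¬ M.intersectionGraph.IsUniversal A :=
    fun A => not_congr mem_universalArcs
  by_cases hU : ∃ u, M.intersectionGraph.IsUniversal u
  swap
  · push Not at hU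
    refine IsPHCAGraph.of_induce (hI.isPHCA.isPHCAGraph (M.induceEmbedding _)) (.inl ?_)
    ext A
    simpa using (hS A).2 (hU A)
  obtain ⟨u, hu⟩ := hU
  refine IsPHCAGraph.of_induce (S := insert u {A | A.1 ∈ M.universalArcsᶜ}) ?_
    (.inr ⟨⟨u, .inl rfl, hu⟩, fun v hv => ?_⟩)
  swap
  · by_contra h
    exact hv (.inr ((hS v).2 h))
  -- If every arc is universal, the single arc `u` serves as the model to start from.
  rcases (M.submodel M.universalArcsᶜ).arcs.eq_empty_or_nonempty with he | hne
  · have hempty : {A : M.arcs | A.1 ∈ M.universalArcsᶜ} = ∅ := by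
      ext A
      exact iff_of_false (fun hA => Set.notMem_empty A.1 (he ▸ ⟨A.2, hA⟩)) (Set.notMem_empty A)
    have hN : (M.submodel {u.1}).IsPHCA := by
      refine ⟨hM.submodel _, fun F hF hFm => ?_⟩
      rcases F.eq_empty_or_nonempty with rfl | ⟨A, hA⟩
      · exact ⟨(0 : AddCircle M.length), by simp⟩
      · obtain ⟨p, hp, -⟩ := hFm A hA A hA
        refine ⟨p, fun B hB => ?_⟩
        have h1 : A = u.1 := (hF hA).2
        have h2 : B = u.1 := (hF hB).2
        rwa [h2, ← h1]
    rw [hempty]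
    have heq : (insert u ∅ : Set M.arcs) = {A | A.1 ∈ ({u.1} : Set (CircleArc M.length))} := by
      ext A
      simp [Subtype.ext_iff]
    rw [heq]
    exact hN.isPHCAGraph (M.induceEmbedding _)
  · obtain ⟨A, hA, hAN, hAm⟩ := hI.exists_insert_universal hne (by
        rintro B ⟨hB, hB'⟩
        have h1 := (hS ⟨B, hB⟩).1 hB'
        simp only [IsUniversal, not_forall] at h1
        obtain ⟨C, hBC, hn⟩ := h1
        -- A non-neighbour of an arc is itself non-universal, hence survives in `U₀`.
        refine ⟨C.1, ⟨C.2, (hS C).2 fun hC => hn (hC (Ne.symm hBC)).symm⟩,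
          fun e => hBC (Subtype.ext e), fun h => hn ⟨hBC, h⟩⟩) (by
        rintro B ⟨hB, hB'⟩ C ⟨hC, hC'⟩ D ⟨hD, hD'⟩ hBC hBD hCD nBC nBD nCD
        obtain ⟨f, hf⟩ := exists_isCoordinate B.start
        have hadj : ∀ E (hE : E ∈ M.arcs), E ∈ M.universalArcsᶜ →
            M.intersectionGraph.Adj u ⟨E, hE⟩ := fun E hE hE' => hu fun e =>
          (hS ⟨E, hE⟩).1 hE' (e ▸ hu)
        exact (hM.properArcs hf).not_claw (hadj B hB hB') (hadj C hC hC') (hadj D hD hD')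
          (fun e => hBC (congrArg Subtype.val e)) (fun e => hBD (congrArg Subtype.val e))
          (fun e => hCD (congrArg Subtype.val e)) (fun h => nBC h.2) (fun h => nBD h.2)
          (fun h => nCD h.2))
    refine isPHCAGraph_induce_insert (M.induceEmbedding _) hA hAN fun x => ?_
    refine iff_of_true (hAm _ (M.induceEmbedding _ x).2) (hu fun e => (hS _).1 x.2 (e ▸ hu))

/-- Sufficiency passes through (iii), for an arbitrary choice of `U₁` and `U₀`. -/
theorem IsProper.exists_isPHCA_iff (hM : M.IsProper) :
    (∃ N : CircularArcModel, N.IsPHCA ∧ M.Equivalent N) ↔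
      ¬ (wheelGraph 4).IsIndContained M.intersectionGraph ∧
        ¬ threeSun.IsIndContained M.intersectionGraph := by
  constructor
  · rintro ⟨N, hN, ⟨φ⟩⟩
    exact ⟨fun ⟨ψ⟩ => hN.not_wheelGraph ⟨ψ.trans φ.toEmbedding⟩,
      fun ⟨ψ⟩ => hN.not_threeSun ⟨ψ.trans φ.toEmbedding⟩⟩
  · rintro ⟨hW, hS⟩
    obtain ⟨M₁, h₁⟩ := M.exists_isU 1
    obtain ⟨M₀, h₀⟩ := M.exists_isU 0
    rcases hM.isHCA_or_isPIG h₁ h₀ hW hS with h | h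
    · exact isPHCAGraph_of_isHCA hM h₁ h
    · exact isPHCAGraph_of_isPIG hM h₀ h

end CircularArcModel

theorem mainTheorem5 :
    (∀ M : CircularArcModel, M.IsPCA →
      ∀ M₁ M₀ : CircularArcModel, M.IsU 1 M₁ → M.IsU 0 M₀ →
        List.TFAE [
          ∃ N : CircularArcModel, N.IsPHCA ∧ M.Equivalent N,
          ¬ M.HasInducedSubmodelOf (wheelGraph 4) ∧ ¬ M.HasInducedSubmodelOf threeSun,
          M₁.IsHCA ∨ M₀.IsPIG]) ∧
    (∀ {V : Type*} (G : SimpleGraph V), IsPCAGraph G →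
      (IsPHCAGraph G ↔
        ¬ (wheelGraph 4).IsIndContained G ∧ ¬ threeSun.IsIndContained G)) := by
  refine ⟨fun M hM M₁ M₀ h₁ h₀ => ?_, fun {V} G ⟨M, hM, ⟨φ⟩⟩ => ?_⟩
  · rw [hasInducedSubmodelOf_iff, hasInducedSubmodelOf_iff]
    tfae_have 1 ↔ 2 := IsProper.exists_isPHCA_iff hM
    tfae_have 2 → 3 := fun h => IsProper.isHCA_or_isPIG hM h₁ h₀ h.1 h.2
    tfae_have 3 → 1 := by
      rintro (h | h)
      exacts [isPHCAGraph_of_isHCA hM h₁ h, isPHCAGraph_of_isPIG hM h₀ h]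
    tfae_finish
  · have hG : ∀ {W : Type} (H : SimpleGraph W),
        H.IsIndContained G ↔ H.IsIndContained M.intersectionGraph := fun H =>
      ⟨fun ⟨ψ⟩ => ⟨ψ.trans φ.toEmbedding⟩, fun ⟨ψ⟩ => ⟨ψ.trans φ.symm.toEmbedding⟩⟩
    rw [hG, hG, ← IsProper.exists_isPHCA_iff hM]
    exact ⟨fun h => h.of_iso φ.symm, fun h => IsPHCAGraph.of_iso h φ⟩
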